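/- Let $K$ be a complex (affine) algebraic group with Lie algebra $\mathfrak k$. Let $\mathcal A$ be an associative unital algebra over $\mathbb C$ with an algebraic action $\phi$ of $K$ by algebra automorphisms and a $K$-equivariant Lie algebra morphism $\psi:\mathfrak k\to\mathcal A$ such that $d\phi(\xi)(a)=[\psi(\xi),a]$ for $\xi\in\mathfrak k$, $a\in\mathcal A$. Let $\mathcal D$ be a ($\mathbb Z$-graded) DG algebra over $\mathbb C$ with an algebraic action $\chi$ of $K$ by DG algebra automorphisms and a $K$-equivariant morphism $\rho:\mathfrak k\to\mathcal D$ of DG Lie algebras ($\mathfrak k$ being placed in degree $0$ with zero differential) such that $d\chi(\xi)(x)=[\rho(\xi),x]$ for $\xi\in\mathfrak k$, $x\in\mathcal D$. An $(\mathcal A,K,\mathcal D)$-module is a complex $V$ of complex vector spaces with an action $\pi$ of $\mathcal A$ by chain maps, an algebraic action $\nu$ of $K$ by chain maps, and a DG action $\omega$ of $\mathcal D$ (so $d(\omega(x)v)=\omega(dx)v+(-1)^{\deg x}\omega(x)dv$), such that $\pi$ and $\omega$ commute, both are $K$-equivariant, and $d\nu(\xi)=\pi(\psi(\xi))+\omega(\rho(\xi))$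 for all $\xi\in\mathfrak k$. Morphisms are the chain maps that commute with all the actions. A homotopy is a homotopy $h$ of chain maps, of degree $-1$, that commutes with $\mathcal A$ and $K$ and satisfies $h(\omega(x)v)=(-1)^{\deg x}\omega(x)h(v)$. DG modules over $\mathcal D$, their morphisms and homotopies are defined in the same way, with only the action of $\mathcal D$. In either category, an object is acyclic if its cohomology vanishes, and an object $P$ is K-projective if every morphism from $P$ to an acyclic object is homotopic to $0$. **Proposition 2.3.** Assume that $K$ is reductive (its unipotent radical is trivial; $K$ need not be connected) and that $\mathcal A$ is freely generated by a $K$-submodule as a $\mathcal U(\mathfrak k)$-module for the left multiplication, i.e. there is a $K$-invariant subspace $\mathcal P\subset\mathcal A$ such that $u\otimes p\mapsto\psi(u)p$ is a bijection $\mathcal U(\mathfrak k)\otimes_{\mathbb C}\mathcal P\to\mathcal A$. Then the forgetful functor from the category of $(\mathcal A,K,\mathcal D)$-modules to the category of DG modules over $\mathcal D$ preserves K-projectives. -/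

import Mathlib

open CategoryTheory TensorProduct

universe u

-- the commutator bracket on an associative ring
attribute [local instance 100] LieRing.ofAssociativeRing

/-! ## Affine algebraic groups over the complex numbers -/

/-- The structure of a complex (affine) algebraic group on a group `K`: a finitely generated algebra
`regular` of complex functions on `K`, the regular functions, such that the points of `K` are exactly
the `ℂ`-algebra homomorphisms `regular → ℂ`, and such that multiplication and inversion are
morphisms of varieties. -/
class AffineAlgGroup (K : Type u) [Group K] where
  regular : Subalgebra ℂ (K → ℂ)
  regular_fg : regular.FG
  point_bijective : Function.Bijective
    (fun k : K => ((Pi.evalAlgHom ℂ (fun _ : K => ℂ) k).comp regular.val : regular →ₐ[ℂ] ℂ))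
  mul_regular : ∀ f ∈ regular, ∃ (n : ℕ) (g h : Fin n → regular),
    ∀ x y : K, f (x * y) = ∑ i, (g i : K → ℂ) x * (h i : K → ℂ) y
  inv_regular : ∀ f ∈ regular, (fun x => f x⁻¹) ∈ regular

namespace AffineAlgGroup

/-- The ring of regular functions `R(K)`. -/
abbrev Reg (K : Type u) [Group K] [AffineAlgGroup K] : Subalgebra ℂ (K → ℂ) :=
  AffineAlgGroup.regular

theorem left_mem {K : Type u} [Group K] [AffineAlgGroup K] (g : K) (f : Reg K) :
    (fun x => (f : K → ℂ) (g * x)) ∈ Reg K := by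
  obtain ⟨n, a, b, h⟩ := mul_regular (f : K → ℂ) f.2
  have : (fun x => (f : K → ℂ) (g * x)) = ∑ i, (a i : K → ℂ) g • (b i : K → ℂ) := by
    funext x
    simp [h, Finset.sum_apply]
  rw [this]
  exact sum_mem fun i _ => (Reg K).smul_mem (b i).2 _

theorem right_mem {K : Type u} [Group K] [AffineAlgGroup K] (g : K) (f : Reg K) :
    (fun x => (f : K → ℂ) (x * g)) ∈ Reg K := by
  obtain ⟨n, a, b, h⟩ := mul_regular (f : K → ℂ) f.2
  have : (fun x => (f : K → ℂ) (x * g)) = ∑ i, (b i : K → ℂ) g • (a i : K → ℂ) := by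
    funext x
    simp [h, Finset.sum_apply, mul_comm]
  rw [this]
  exact sum_mem fun i _ => (Reg K).smul_mem (a i).2 _

/-- Left translation of regular functions, `f ↦ (x ↦ f (g * x))`. -/
def leftTr {K : Type u} [Group K] [AffineAlgGroup K] (g : K) : Reg K →ₐ[ℂ] Reg K where
  toFun f := ⟨fun x => (f : K → ℂ) (g * x), left_mem g f⟩
  map_one' := rfl
  map_mul' _ _ := rfl
  map_zero' := rfl
  map_add' _ _ := rfl
  commutes' _ := rfl

/-- Right translation of regular functions, `f ↦ (x ↦ f (x * g))`. -/
def rightTr {K : Type u} [Group K] [AffineAlgGroup K] (g : K) : Reg K →ₐ[ℂ] Reg K where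
  toFun f := ⟨fun x => (f : K → ℂ) (x * g), right_mem g f⟩
  map_one' := rfl
  map_mul' _ _ := rfl
  map_zero' := rfl
  map_add' _ _ := rfl
  commutes' _ := rfl

theorem leftTr_rightTr {K : Type u} [Group K] [AffineAlgGroup K] (g k : K) (f : Reg K) :
    leftTr g (rightTr k f) = rightTr k (leftTr g f) := by
  apply Subtype.ext
  funext x
  change (f : K → ℂ) (g * x * k) = (f : K → ℂ) (g * (x * k))
  rw [mul_assoc]

theorem rightTr_inv {K : Type u} [Group K] [AffineAlgGroup K] (k : K) (f : Reg K) :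
    rightTr k (rightTr k⁻¹ f) = f := by
  apply Subtype.ext
  funext x
  change (f : K → ℂ) (x * k * k⁻¹) = (f : K → ℂ) x
  rw [mul_inv_cancel_right]

/-- The Lie algebra `𝔨` of `K`: the left invariant vector fields, that is, the derivations of the
ring of regular functions which commute with left translations, with the commutator bracket. -/
def lieAlg (K : Type u) [Group K] [AffineAlgGroup K] :
    LieSubalgebra ℂ (Derivation ℂ (Reg K) (Reg K)) where
  carrier := {ξ | ∀ (g : K) (f : Reg K), ξ (leftTr g f) = leftTr g (ξ f)}
  add_mem' := by
    intro a b ha hb g f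
    simp [ha g f, hb g f]
  zero_mem' := by
    intro g f
    simp
  smul_mem' := by
    intro c a ha g f
    simp [ha g f]
  lie_mem' := by
    intro a b ha hb g f
    simp [Derivation.commutator_apply, ha g, hb g]

/-- The tangent vector at the identity `f ↦ (ξ f)(1)` given by an element of the Lie algebra. -/
def atOne {K : Type u} [Group K] [AffineAlgGroup K] (ξ : lieAlg K) (f : Reg K) : ℂ :=
  ((ξ : Derivation ℂ (Reg K) (Reg K)) f : K → ℂ) 1

/-- The adjoint action of `K` on its Lie algebra. -/
def Ad {K : Type u} [Group K] [AffineAlgGroup K] (k : K) (ξ : lieAlg K) : lieAlg K :=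
  ⟨Derivation.mk' ((rightTr k).toLinearMap ∘ₗ
      ((ξ : Derivation ℂ (Reg K) (Reg K)) : Reg K →ₗ[ℂ] Reg K) ∘ₗ (rightTr k⁻¹).toLinearMap)
    (by
      intro f g
      simp [Derivation.leibniz, rightTr_inv]), by
    intro g f
    have h := ξ.2 g (rightTr k⁻¹ f)
    change rightTr k (ξ.1 (rightTr k⁻¹ (leftTr g f))) = leftTr g (rightTr k (ξ.1 (rightTr k⁻¹ f)))
    rw [← leftTr_rightTr, h, leftTr_rightTr]⟩

/-- The Zariski topology of `K`, with basis the sets `{f ≠ 0}`, `f` regular. -/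
abbrev zariski (K : Type u) [Group K] [AffineAlgGroup K] : TopologicalSpace K :=
  TopologicalSpace.generateFrom {U | ∃ f ∈ Reg K, U = {x | f x ≠ 0}}

/-- An element `k` of `K` is unipotent if right translation by `k` is a locally unipotent
endomorphism of the ring of regular functions. -/
def IsUnipotent {K : Type u} [Group K] [AffineAlgGroup K] (k : K) : Prop :=
  ∀ f : Reg K, ∃ n : ℕ, (((rightTr k).toLinearMap - 1 : Module.End ℂ (Reg K)) ^ n) f = 0

/-- `K` is reductive: its unipotent radical is trivial, i.e. every connected closed normal
subgroup of `K` that consists of unipotent elements is trivial (`K` need not be connected). -/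
def IsReductive (K : Type u) [Group K] [AffineAlgGroup K] : Prop :=
  ∀ H : Subgroup K, H.Normal → @IsClosed K (zariski K) (H : Set K) →
    @IsConnected K (zariski K) (H : Set K) → (∀ k ∈ H, IsUnipotent k) → H = ⊥

/-- A linear action of `K` on a (possibly infinite dimensional) space `V` is algebraic if every
orbit map `k ↦ ν(k)v` is a regular function `k ↦ ∑ i, f i k • w i` from `K` to `V`. -/
def IsAlgebraic {K : Type u} [Group K] [AffineAlgGroup K] {V : Type u} [AddCommGroup V]
    [Module ℂ V] (ν : Representation ℂ K V) : Prop :=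
  ∀ v : V, ∃ (n : ℕ) (f : Fin n → Reg K) (w : Fin n → V),
    ∀ k : K, ν k v = ∑ i, (f i : K → ℂ) k • w i

/-- `T` is the operator `dν(ξ)`, the differential at `1` of the algebraic action `ν` in the
direction `ξ`: if `ν(k)v = ∑ i, f i k • w i`, then `T v = ∑ i, (ξ (f i))(1) • w i`. -/
def IsDifferential {K : Type u} [Group K] [AffineAlgGroup K] {V : Type u} [AddCommGroup V]
    [Module ℂ V] (ν : Representation ℂ K V) (ξ : lieAlg K) (T : V → V) : Prop :=
  ∀ (v : V) (n : ℕ) (f : Fin n → Reg K) (w : Fin n → V),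
    (∀ k : K, ν k v = ∑ i, (f i : K → ℂ) k • w i) → T v = ∑ i, atOne ξ (f i) • w i

end AffineAlgGroup

open AffineAlgGroup

/-! ## Algebras with compatible actions of `K` and `𝔨` -/

/-- The representation of `K` underlying an action by algebra automorphisms. -/
def algRep {K : Type u} [Group K] {A : Type u} [Ring A] [Algebra ℂ A]
    (φ : K →* (A ≃ₐ[ℂ] A)) : Representation ℂ K A where
  toFun k := (φ k).toLinearMap
  map_one' := by
    ext a
    simp
  map_mul' x y := by
    ext a
    simp

/-- The data making an associative algebra `A` into a `K`-algebra: an algebraic action `φ` of `K` by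
algebra automorphisms and a `K`-equivariant Lie algebra morphism `ψ : 𝔨 → A` with
`dφ(ξ)(a) = [ψ(ξ), a]`. -/
structure KAlgebra (K : Type u) [Group K] [AffineAlgGroup K] (A : Type u) [Ring A]
    [Algebra ℂ A] where
  φ : K →* (A ≃ₐ[ℂ] A)
  algebraic : IsAlgebraic (algRep φ)
  ψ : lieAlg K →ₗ⁅ℂ⁆ A
  equivariant : ∀ (k : K) (ξ : lieAlg K), ψ (Ad k ξ) = φ k (ψ ξ)
  differential : ∀ ξ : lieAlg K, IsDifferential (algRep φ) ξ (fun a => ψ ξ * a - a * ψ ξ)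

/-- A differential of degree `1` making the graded algebra `D = ⨁ i, 𝒟 i` a DG algebra over `ℂ`. -/
structure DGAlgebra {D : Type u} [Ring D] [Algebra ℂ D] (𝒟 : ℤ → Submodule ℂ D)
    [GradedAlgebra 𝒟] where
  d : D →ₗ[ℂ] D
  d_mem : ∀ {i : ℤ} {x : D}, x ∈ 𝒟 i → d x ∈ 𝒟 (i + 1)
  d_d : ∀ x : D, d (d x) = 0
  leibniz : ∀ {i : ℤ} {x : D}, x ∈ 𝒟 i → ∀ y : D, d (x * y) = d x * y + i.negOnePow • (x * d y)

/-- The data making a DG algebra `D` into a `K`-equivariant one: an algebraic action `φ` of `K`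
by DG algebra automorphisms and a `K`-equivariant morphism `ψ : 𝔨 → D` of DG Lie algebras
(`𝔨` being in degree `0` with zero differential) with `dφ(ξ)(x) = [ψ(ξ), x]`. As `ψ(ξ)` has degree
`0`, the graded commutator is the ordinary one. -/
structure KDGAlgebra (K : Type u) [Group K] [AffineAlgGroup K] {D : Type u} [Ring D]
    [Algebra ℂ D] {𝒟 : ℤ → Submodule ℂ D} [GradedAlgebra 𝒟] (δ : DGAlgebra 𝒟)
    extends KAlgebra K D where
  φ_mem : ∀ (k : K) {i : ℤ} {x : D}, x ∈ 𝒟 i → φ k x ∈ 𝒟 i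
  φ_d : ∀ (k : K) (x : D), φ k (δ.d x) = δ.d (φ k x)
  ψ_mem : ∀ ξ : lieAlg K, ψ ξ ∈ 𝒟 0
  d_ψ : ∀ ξ : lieAlg K, δ.d (ψ ξ) = 0

/-- `A` is freely generated by a `K`-submodule as a `𝒰(𝔨)`-module for the left multiplication:
there is a `K`-stable subspace `P` of `A` such that `u ⊗ p ↦ ψ(u) p` is a bijection from `𝒰(𝔨) ⊗ P`
to `A`, where `ψ` is extended to the universal enveloping algebra. -/
def KAlgebra.IsFreeOnKSubmodule {K : Type u} [Group K] [AffineAlgGroup K] {A : Type u} [Ring A]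
    [Algebra ℂ A] (α : KAlgebra K A) : Prop :=
  ∃ P : Submodule ℂ A, (∀ (k : K), ∀ p ∈ P, α.φ k p ∈ P) ∧
    Function.Bijective (TensorProduct.lift
      ((LinearMap.mul ℂ A).compl₁₂ (UniversalEnvelopingAlgebra.lift ℂ α.ψ).toLinearMap P.subtype))

/-! ## DG modules -/

/-- A (left, unital) DG module over the DG algebra `D`: a complex of vector spaces with a graded
action of `D` satisfying the Leibniz rule. `act i j k _ x v` is `x v` for `x` of degree `i` and `v` of
degree `j`, an element of degree `k = i + j`. -/
structure DGModule {D : Type u} [Ring D] [Algebra ℂ D] {𝒟 : ℤ → Submodule ℂ D} [GradedAlgebra 𝒟]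
    (δ : DGAlgebra 𝒟) where
  cpx : CochainComplex (ModuleCat.{u} ℂ) ℤ
  act : ∀ i j k : ℤ, i + j = k → (𝒟 i →ₗ[ℂ] cpx.X j →ₗ[ℂ] cpx.X k)
  one_act : ∀ (j : ℤ) (v : cpx.X j),
    act 0 j j (zero_add j) ⟨1, SetLike.GradedOne.one_mem⟩ v = v
  mul_act : ∀ (i i' j k l : ℤ) (h : i' + j = k) (h' : i + k = l) (x : 𝒟 i) (y : 𝒟 i')
    (v : cpx.X j),
    act (i + i') j l (by omega) ⟨x * y, SetLike.GradedMul.mul_mem x.2 y.2⟩ v =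
      act i k l h' x (act i' j k h y v)
  d_act : ∀ (i j k : ℤ) (h : i + j = k) (x : 𝒟 i) (v : cpx.X j),
    cpx.d k (k + 1) (act i j k h x v) =
      act (i + 1) j (k + 1) (by omega) ⟨δ.d x, δ.d_mem x.2⟩ v +
        i.negOnePow • act i (j + 1) (k + 1) (by omega) x (cpx.d j (j + 1) v)

namespace DGModule

/-- A morphism of DG modules: a chain map commuting with the action of `D`. -/
@[ext]
structure Hom {D : Type u} [Ring D] [Algebra ℂ D] {𝒟 : ℤ → Submodule ℂ D} [GradedAlgebra 𝒟]
    {δ : DGAlgebra 𝒟} (V W : DGModule δ) where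
  chain : V.cpx ⟶ W.cpx
  map_act : ∀ (i j k : ℤ) (h : i + j = k) (x : 𝒟 i) (v : V.cpx.X j),
    chain.f k (V.act i j k h x v) = W.act i j k h x (chain.f j v)

/-- The identity morphism. -/
def Hom.id {D : Type u} [Ring D] [Algebra ℂ D] {𝒟 : ℤ → Submodule ℂ D} [GradedAlgebra 𝒟]
    {δ : DGAlgebra 𝒟} (V : DGModule δ) : Hom V V :=
  ⟨𝟙 V.cpx, by simp⟩

/-- Composition of morphisms. -/
def Hom.comp {D : Type u} [Ring D] [Algebra ℂ D] {𝒟 : ℤ → Submodule ℂ D} [GradedAlgebra 𝒟]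
    {δ : DGAlgebra 𝒟} {U V W : DGModule δ} (f : Hom U V) (g : Hom V W) : Hom U W :=
  ⟨f.chain ≫ g.chain, by simp [f.map_act, g.map_act]⟩

/-- The category `ℳ(𝒟)` of DG modules. -/
instance {D : Type u} [Ring D] [Algebra ℂ D] {𝒟 : ℤ → Submodule ℂ D} [GradedAlgebra 𝒟]
    (δ : DGAlgebra 𝒟) : Category (DGModule δ) where
  Hom := Hom
  id := Hom.id
  comp := Hom.comp
  id_comp _ := Hom.ext (Category.id_comp _)
  comp_id _ := Hom.ext (Category.comp_id _)
  assoc _ _ _ := Hom.ext (Category.assoc _ _ _)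

/-- A DG module is acyclic if the cohomology of its underlying complex vanishes. -/
def Acyclic {D : Type u} [Ring D] [Algebra ℂ D] {𝒟 : ℤ → Submodule ℂ D} [GradedAlgebra 𝒟]
    {δ : DGAlgebra 𝒟} (V : DGModule δ) : Prop :=
  V.cpx.Acyclic

/-- A homotopy `h` (of degree `-1`) is graded `D`-linear: `h(x v) = (-1)^(deg x) x h(v)`. -/
def IsLinearHomotopy {D : Type u} [Ring D] [Algebra ℂ D] {𝒟 : ℤ → Submodule ℂ D}
    [GradedAlgebra 𝒟] {δ : DGAlgebra 𝒟} {V W : DGModule δ} {f g : V ⟶ W}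
    (h : Homotopy f.chain g.chain) : Prop :=
  ∀ (i j k l m : ℤ) (hjk : i + j = k) (hlm : i + l = m) (x : 𝒟 i) (v : V.cpx.X j),
    h.hom k m (V.act i j k hjk x v) = i.negOnePow • W.act i l m hlm x (h.hom j l v)

/-- The zero morphism. -/
def zeroHom {D : Type u} [Ring D] [Algebra ℂ D] {𝒟 : ℤ → Submodule ℂ D} [GradedAlgebra 𝒟]
    {δ : DGAlgebra 𝒟} (V W : DGModule δ) : V ⟶ W :=
  Hom.mk 0 (by simp)

/-- `P` is K-projective if every morphism from `P` to an acyclic DG module is homotopic to zero,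
i.e. is zero in the homotopic category. -/
def IsKProjective {D : Type u} [Ring D] [Algebra ℂ D] {𝒟 : ℤ → Submodule ℂ D} [GradedAlgebra 𝒟]
    {δ : DGAlgebra 𝒟} (P : DGModule δ) : Prop :=
  ∀ (Z : DGModule δ), Z.Acyclic → ∀ f : P ⟶ Z,
    ∃ h : Homotopy f.chain (zeroHom P Z).chain, IsLinearHomotopy h

end DGModule

/-! ## `(A, K, D)`-modules -/

/-- An `(A, K, D)`-module: a DG module over `D` with an action `π` of `A` by chain maps and an
algebraic action `ν` of `K` by chain maps, such that the actions of `A` and `D` commute and are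
`K`-equivariant, and such that on `𝔨` the sum of the actions of `A` and `D` is the differential
of `ν`. -/
structure AKDModule {K : Type u} [Group K] [AffineAlgGroup K] {A : Type u} [Ring A]
    [Algebra ℂ A] (α : KAlgebra K A) {D : Type u} [Ring D] [Algebra ℂ D]
    {𝒟 : ℤ → Submodule ℂ D} [GradedAlgebra 𝒟] {δ : DGAlgebra 𝒟} (β : KDGAlgebra K δ)
    extends DGModule δ where
  π : ∀ i : ℤ, A →ₐ[ℂ] Module.End ℂ (cpx.X i)
  π_d : ∀ (i j : ℤ) (a : A) (v : cpx.X i), cpx.d i j (π i a v) = π j a (cpx.d i j v)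
  ν : ∀ i : ℤ, Representation ℂ K (cpx.X i)
  ν_algebraic : ∀ i : ℤ, IsAlgebraic (ν i)
  ν_d : ∀ (i j : ℤ) (k : K) (v : cpx.X i), cpx.d i j (ν i k v) = ν j k (cpx.d i j v)
  π_act : ∀ (i j l : ℤ) (h : i + j = l) (a : A) (x : 𝒟 i) (v : cpx.X j),
    π l a (act i j l h x v) = act i j l h x (π j a v)
  ν_π : ∀ (i : ℤ) (k : K) (a : A) (v : cpx.X i),
    ν i k (π i a v) = π i (α.φ k a) (ν i k v)
  ν_act : ∀ (i j l : ℤ) (h : i + j = l) (k : K) (x : 𝒟 i) (v : cpx.X j),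
    ν l k (act i j l h x v) = act i j l h ⟨β.φ k x, β.φ_mem k x.2⟩ (ν j k v)
  differential : ∀ (i : ℤ) (ξ : lieAlg K), IsDifferential (ν i) ξ
    (fun v => π i (α.ψ ξ) v + act 0 i i (zero_add i) ⟨β.ψ ξ, β.ψ_mem ξ⟩ v)

namespace AKDModule

/-- A morphism of `(A, K, D)`-modules: a chain map commuting with all three actions. -/
@[ext]
structure Hom {K : Type u} [Group K] [AffineAlgGroup K] {A : Type u} [Ring A] [Algebra ℂ A]
    {α : KAlgebra K A} {D : Type u} [Ring D] [Algebra ℂ D] {𝒟 : ℤ → Submodule ℂ D}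
    [GradedAlgebra 𝒟] {δ : DGAlgebra 𝒟} {β : KDGAlgebra K δ} (V W : AKDModule α β)
    extends DGModule.Hom V.toDGModule W.toDGModule where
  map_π : ∀ (i : ℤ) (a : A) (v : V.cpx.X i), chain.f i (V.π i a v) = W.π i a (chain.f i v)
  map_ν : ∀ (i : ℤ) (k : K) (v : V.cpx.X i), chain.f i (V.ν i k v) = W.ν i k (chain.f i v)

/-- The category `ℳ(A, K, D)`. -/
instance {K : Type u} [Group K] [AffineAlgGroup K] {A : Type u} [Ring A] [Algebra ℂ A]
    (α : KAlgebra K A) {D : Type u} [Ring D] [Algebra ℂ D] {𝒟 : ℤ → Submodule ℂ D}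
    [GradedAlgebra 𝒟] {δ : DGAlgebra 𝒟} (β : KDGAlgebra K δ) : Category (AKDModule α β) where
  Hom := Hom
  id V := ⟨DGModule.Hom.id V.toDGModule, fun _ _ _ => rfl, fun _ _ _ => rfl⟩
  comp {U V W} f g :=
    { toHom := DGModule.Hom.comp f.toHom g.toHom
      map_π := fun i a v => by
        change g.chain.f i (f.chain.f i (U.π i a v)) = W.π i a (g.chain.f i (f.chain.f i v))
        rw [f.map_π, g.map_π]
      map_ν := fun i k v => by
        change g.chain.f i (f.chain.f i (U.ν i k v)) = W.ν i k (g.chain.f i (f.chain.f i v))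
        rw [f.map_ν, g.map_ν] }
  id_comp _ := Hom.ext (Category.id_comp _)
  comp_id _ := Hom.ext (Category.comp_id _)
  assoc _ _ _ := Hom.ext (Category.assoc _ _ _)

/-- The forgetful functor from `(A, K, D)`-modules to DG modules over `D`. -/
def forget {K : Type u} [Group K] [AffineAlgGroup K] {A : Type u} [Ring A] [Algebra ℂ A]
    (α : KAlgebra K A) {D : Type u} [Ring D] [Algebra ℂ D] {𝒟 : ℤ → Submodule ℂ D}
    [GradedAlgebra 𝒟] {δ : DGAlgebra 𝒟} (β : KDGAlgebra K δ) : AKDModule α β ⥤ DGModule δ where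
  obj V := V.toDGModule
  map f := f.toHom

/-- An `(A, K, D)`-module is acyclic if the cohomology of its underlying complex vanishes. -/
def Acyclic {K : Type u} [Group K] [AffineAlgGroup K] {A : Type u} [Ring A] [Algebra ℂ A]
    {α : KAlgebra K A} {D : Type u} [Ring D] [Algebra ℂ D] {𝒟 : ℤ → Submodule ℂ D}
    [GradedAlgebra 𝒟] {δ : DGAlgebra 𝒟} {β : KDGAlgebra K δ} (V : AKDModule α β) : Prop :=
  V.cpx.Acyclic

/-- A homotopy of `(A, K, D)`-modules commutes with `A` and `K`, and is graded `D`-linear. -/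
def IsLinearHomotopy {K : Type u} [Group K] [AffineAlgGroup K] {A : Type u} [Ring A]
    [Algebra ℂ A] {α : KAlgebra K A} {D : Type u} [Ring D] [Algebra ℂ D]
    {𝒟 : ℤ → Submodule ℂ D} [GradedAlgebra 𝒟] {δ : DGAlgebra 𝒟} {β : KDGAlgebra K δ}
    {V W : AKDModule α β} {f g : V ⟶ W} (h : Homotopy f.chain g.chain) : Prop :=
  DGModule.IsLinearHomotopy (f := (forget α β).map f) (g := (forget α β).map g) h ∧
    (∀ (i j : ℤ) (a : A) (v : V.cpx.X i), h.hom i j (V.π i a v) = W.π j a (h.hom i j v)) ∧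
    (∀ (i j : ℤ) (k : K) (v : V.cpx.X i), h.hom i j (V.ν i k v) = W.ν j k (h.hom i j v))

/-- The zero morphism. -/
def zeroHom {K : Type u} [Group K] [AffineAlgGroup K] {A : Type u} [Ring A] [Algebra ℂ A]
    {α : KAlgebra K A} {D : Type u} [Ring D] [Algebra ℂ D] {𝒟 : ℤ → Submodule ℂ D}
    [GradedAlgebra 𝒟] {δ : DGAlgebra 𝒟} {β : KDGAlgebra K δ} (V W : AKDModule α β) : V ⟶ W :=
  Hom.mk (DGModule.zeroHom V.toDGModule W.toDGModule)
    (by simp [DGModule.zeroHom]) (by simp [DGModule.zeroHom])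

/-- `P` is K-projective if every morphism from `P` to an acyclic `(A, K, D)`-module is homotopic to
zero, i.e. is zero in the homotopic category. -/
def IsKProjective {K : Type u} [Group K] [AffineAlgGroup K] {A : Type u} [Ring A] [Algebra ℂ A]
    {α : KAlgebra K A} {D : Type u} [Ring D] [Algebra ℂ D] {𝒟 : ℤ → Submodule ℂ D}
    [GradedAlgebra 𝒟] {δ : DGAlgebra 𝒟} {β : KDGAlgebra K δ} (P : AKDModule α β) : Prop :=
  ∀ (Z : AKDModule α β), Z.Acyclic → ∀ f : P ⟶ Z,
    ∃ h : Homotopy f.chain (zeroHom P Z).chain, IsLinearHomotopy h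

end AKDModule

/-!
The forgetful functor has a right adjoint which preserves acyclic objects, and any functor with such
a right adjoint preserves K-projectives: a morphism `f : V → Z` of DG modules over `D` to an acyclic
`Z` factors as `V → Ind Z → Z`, where the first map is a morphism of `(A, K, D)`-modules to an
acyclic object, so a null homotopy of the first map gives one of `f`.

The right adjoint is built by hand. To a vector `v` of `V` one attaches its matrix coefficient
`F k a = f (a * ν(k) v)`, a regular map from `K` to `Hom(A, Z)`. The compatibility of `dν` with the
actions of `A` and `D` says that the derivative of `F (x * k) a` at `x = 1` in the direction `ξ` is
`F k (a * ψ ξ) + ρ(ξ) (F k a)`, and `Ind Z` consists of all regular `F` with this property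
(`coind`, `coindModule`). The maps `coindLift` and `coindCounit` are the two halves of the adjunction
that are needed.

For the acyclicity of `Ind Z` (`acyclic_coindModule`), restriction to the generating subspace `P`
identifies `Ind Z`, as a complex, with the space of regular maps from `K` to `Hom(P, Z)`, and this is
exact in `Z`. As `P` is stable under `K`, it is stable under commutators with `ψ(𝔨)`, so it generates
`A` under right multiplications as well, and `F` is determined by its restriction (`coind_eq_zero`).
Conversely a regular map with values in `Hom(P, Z)` involves only a finite dimensional space `S` of
regular functions, which can be taken stable under left translations (`exists_finite_stable`). The
defining condition prescribes how the extension changes under right multiplication by `ψ ξ`, through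
operators on `S ⊗ Z` which form an anti-representation of `𝔨`; the universal property of the
enveloping algebra, with values in an opposite endomorphism algebra, then gives the extension, and
working inside `S ⊗ Z` makes it regular uniformly in `A` (`exists_coind_extension`).
-/

/-! ### Regular maps to vector spaces and their differentials at the identity -/

namespace AffineAlgGroup

section Calculus

variable {K : Type u} [Group K] [AffineAlgGroup K]
variable {U V W : Type*} [AddCommGroup U] [Module ℂ U] [AddCommGroup V] [Module ℂ V]
  [AddCommGroup W] [Module ℂ W]

/-- The value at `k` of an element of `R(K) ⊗ W`, seen as a regular map `K → W`. -/
def evalTensor (k : K) : Reg K ⊗[ℂ] W →ₗ[ℂ] W :=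
  TensorProduct.lift (((LinearMap.lsmul ℂ W : ℂ →ₗ[ℂ] W →ₗ[ℂ] W)) ∘ₗ
    ((LinearMap.proj k : (K → ℂ) →ₗ[ℂ] ℂ) ∘ₗ (Reg K).toSubmodule.subtype))

@[simp]
theorem evalTensor_tmul (k : K) (f : Reg K) (w : W) :
    evalTensor k (f ⊗ₜ[ℂ] w) = (f : K → ℂ) k • w := rfl

/-- `atOne` as a linear form on the ring of regular functions. -/
def atOneLinear (ξ : lieAlg K) : Reg K →ₗ[ℂ] ℂ where
  toFun := atOne ξ
  map_add' f g := by simp [atOne]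
  map_smul' c f := by simp [atOne]

@[simp]
theorem atOneLinear_apply (ξ : lieAlg K) (f : Reg K) : atOneLinear ξ f = atOne ξ f := rfl

/-- The differential at `1` in the direction `ξ` of an element of `R(K) ⊗ W`. -/
def diffTensor (ξ : lieAlg K) : Reg K ⊗[ℂ] W →ₗ[ℂ] W :=
  TensorProduct.lift (((LinearMap.lsmul ℂ W : ℂ →ₗ[ℂ] W →ₗ[ℂ] W)) ∘ₗ atOneLinear ξ)

@[simp]
theorem diffTensor_tmul (ξ : lieAlg K) (f : Reg K) (w : W) :
    diffTensor ξ (f ⊗ₜ[ℂ] w) = atOne ξ f • w := rfl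

/-- A map from `K` to a vector space is regular if it is given by an element of `R(K) ⊗ W`. -/
def IsRegularMap (F : K → W) : Prop := ∃ t : Reg K ⊗[ℂ] W, ∀ k, F k = evalTensor k t

/-- `F : K → W` is regular and its differential at `1` in the direction `ξ` is `w`. -/
def HasDiff (ξ : lieAlg K) (F : K → W) (w : W) : Prop :=
  ∃ t : Reg K ⊗[ℂ] W, (∀ k, F k = evalTensor k t) ∧ w = diffTensor ξ t

theorem IsRegularMap.exists_hasDiff {F : K → W} (h : IsRegularMap F) (ξ : lieAlg K) :
    ∃ w, HasDiff ξ F w := by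
  obtain ⟨t, ht⟩ := h
  exact ⟨_, t, ht, rfl⟩

theorem HasDiff.isRegularMap {ξ : lieAlg K} {F : K → W} {w : W} (h : HasDiff ξ F w) :
    IsRegularMap F := by
  obtain ⟨t, ht, -⟩ := h
  exact ⟨t, ht⟩

theorem HasDiff.congr_diff {ξ : lieAlg K} {F : K → W} {v w : W} (h : HasDiff ξ F v) (e : w = v) :
    HasDiff ξ F w := e ▸ h

theorem hasDiff_smul (ξ : lieAlg K) (f : Reg K) (w : W) :
    HasDiff ξ (fun k => (f : K → ℂ) k • w) (atOne ξ f • w) :=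
  ⟨f ⊗ₜ w, fun _ => rfl, rfl⟩

theorem hasDiff_zero (ξ : lieAlg K) : HasDiff ξ (fun _ : K => (0 : W)) 0 :=
  ⟨0, by simp, by simp⟩

theorem HasDiff.add {ξ : lieAlg K} {F G : K → W} {v w : W} (hF : HasDiff ξ F v)
    (hG : HasDiff ξ G w) : HasDiff ξ (fun k => F k + G k) (v + w) := by
  obtain ⟨s, hs, rfl⟩ := hF
  obtain ⟨t, ht, rfl⟩ := hG
  exact ⟨s + t, fun k => by simp only [hs, ht, map_add], by rw [map_add]⟩

theorem HasDiff.sum {ξ : lieAlg K} {ι : Type*} (s : Finset ι) {F : ι → K → W} {w : ι → W}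
    (h : ∀ i, HasDiff ξ (F i) (w i)) : HasDiff ξ (fun k => ∑ i ∈ s, F i k) (∑ i ∈ s, w i) := by
  choose t ht hw using h
  exact ⟨∑ i ∈ s, t i, fun k => by simp [ht], by simp [hw]⟩

theorem evalTensor_lTensor (T : V →ₗ[ℂ] W) (k : K) (t : Reg K ⊗[ℂ] V) :
    evalTensor k (T.lTensor (Reg K) t) = T (evalTensor k t) := by
  induction t with
  | zero => simp
  | tmul f v => simp
  | add s t hs ht => simp only [map_add, hs, ht]

theorem diffTensor_lTensor (T : V →ₗ[ℂ] W) (ξ : lieAlg K) (t : Reg K ⊗[ℂ] V) :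
    diffTensor ξ (T.lTensor (Reg K) t) = T (diffTensor ξ t) := by
  induction t with
  | zero => simp
  | tmul f v => simp
  | add s t hs ht => simp only [map_add, hs, ht]

theorem HasDiff.map {ξ : lieAlg K} {F : K → V} {v : V} (h : HasDiff ξ F v) (T : V →ₗ[ℂ] W) :
    HasDiff ξ (fun k => T (F k)) (T v) := by
  obtain ⟨t, ht, rfl⟩ := h
  exact ⟨T.lTensor _ t, fun k => by simp only [evalTensor_lTensor, ht], by rw [diffTensor_lTensor]⟩

theorem IsRegularMap.map {F : K → V} (h : IsRegularMap F) (T : V →ₗ[ℂ] W) :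
    IsRegularMap fun k => T (F k) := by
  obtain ⟨t, ht⟩ := h
  exact ⟨T.lTensor _ t, fun k => by simp only [evalTensor_lTensor, ht]⟩

/-- A scalar regular map is a regular function, and its differential is computed by `atOne`. -/
theorem HasDiff.eq_atOne {ξ : lieAlg K} {F : K → ℂ} {c : ℂ} (h : HasDiff ξ F c) :
    ∃ f : Reg K, F = f ∧ c = atOne ξ f := by
  obtain ⟨t, ht, rfl⟩ := h
  suffices H : ∃ f : Reg K, (fun k => evalTensor k t) = (f : K → ℂ) ∧ diffTensor ξ t = atOne ξ f by
    obtain ⟨f, hf, hd⟩ := H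
    exact ⟨f, by rw [← hf]; exact funext ht, hd⟩
  clear ht
  induction t with
  | zero => exact ⟨0, by ext k; simp, by simp [atOne]⟩
  | tmul f c =>
    exact ⟨c • f, by ext k; simp [mul_comm], by
      rw [← atOneLinear_apply, map_smul]; simp [mul_comm]⟩
  | add s t hs ht =>
    obtain ⟨f, hf, hf'⟩ := hs
    obtain ⟨g, hg, hg'⟩ := ht
    refine ⟨f + g, ?_, ?_⟩
    · ext k
      have h1 := congrFun hf k
      have h2 := congrFun hg k
      simp [h1, h2]
    · rw [map_add, hf', hg', ← atOneLinear_apply, ← atOneLinear_apply, ← atOneLinear_apply, map_add]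

/-- The differential of a regular map is well defined: linear forms reduce this to functions. -/
theorem HasDiff.unique {ξ : lieAlg K} {F : K → W} {v w : W} (hv : HasDiff ξ F v)
    (hw : HasDiff ξ F w) : v = w := by
  rw [← sub_eq_zero, ← Module.forall_dual_apply_eq_zero_iff ℂ]
  intro l
  obtain ⟨f, hf, hfv⟩ := (hv.map l).eq_atOne
  obtain ⟨g, hg, hgw⟩ := (hw.map l).eq_atOne
  have : f = g := Subtype.ext (hf.symm.trans hg)
  rw [map_sub, hfv, hgw, this, sub_self]

/-- If a regular map takes values in a subspace, then so does its differential. -/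
theorem HasDiff.mem {ξ : lieAlg K} {F : K → W} {w : W} (h : HasDiff ξ F w) (S : Submodule ℂ W)
    (hS : ∀ k, F k ∈ S) : w ∈ S := by
  have h1 := h.map S.mkQ
  have h2 : (fun k => S.mkQ (F k)) = fun _ => 0 := by
    ext k
    simpa using hS k
  rw [h2] at h1
  simpa using h1.unique (hasDiff_zero ξ)

/-- A regular map with values in a subspace is regular as a map to this subspace. -/
theorem IsRegularMap.codRestrict {S : Submodule ℂ W} {F : K → S}
    (h : IsRegularMap fun k => (F k : W)) : IsRegularMap F := by
  obtain ⟨r, hr⟩ := LinearMap.exists_leftInverse_of_injective S.subtype (Submodule.ker_subtype S)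
  have := h.map r
  convert this using 2 with k
  exact (LinearMap.congr_fun hr (F k)).symm

theorem atOne_mul (ξ : lieAlg K) (f g : Reg K) :
    atOne ξ (f * g) = atOne ξ f * (g : K → ℂ) 1 + (f : K → ℂ) 1 * atOne ξ g := by
  simp [atOne, Derivation.leibniz, mul_comm, add_comm]

/-- The product rule. -/
theorem HasDiff.bilin {ξ : lieAlg K} (B : U →ₗ[ℂ] V →ₗ[ℂ] W) {F : K → U} {G : K → V} {u : U} {v : V}
    (hF : HasDiff ξ F u) (hG : HasDiff ξ G v) :
    HasDiff ξ (fun k => B (F k) (G k)) (B u (G 1) + B (F 1) v) := by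
  obtain ⟨s, hs, rfl⟩ := hF
  obtain ⟨t, ht, rfl⟩ := hG
  simp only [hs, ht]
  clear hs ht
  induction s with
  | zero => simpa using hasDiff_zero ξ
  | add s s' h h' =>
    convert h.add h' using 1
    · ext k; simp
    · simp only [map_add, LinearMap.add_apply]; abel
  | tmul f u =>
    induction t with
    | zero => simpa using hasDiff_zero ξ
    | add t t' h h' =>
      convert h.add h' using 1
      · ext k; simp
      · simp only [map_add]; abel
    | tmul g v =>
      convert hasDiff_smul ξ (f * g) (B u v) using 1
      · ext k; simp [mul_smul, smul_comm ((g : K → ℂ) k)]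
      · rw [atOne_mul]
        simp [mul_smul, add_smul, smul_comm ((g : K → ℂ) 1), smul_comm (atOne ξ g)]

theorem IsRegularMap.bilin (B : U →ₗ[ℂ] V →ₗ[ℂ] W) {F : K → U} {G : K → V}
    (hF : IsRegularMap F) (hG : IsRegularMap G) : IsRegularMap fun k => B (F k) (G k) := by
  obtain ⟨u, hu⟩ := hF.exists_hasDiff 0
  obtain ⟨v, hv⟩ := hG.exists_hasDiff 0
  exact (hu.bilin B hv).isRegularMap

theorem IsRegularMap.add {F G : K → W} (hF : IsRegularMap F) (hG : IsRegularMap G) :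
    IsRegularMap fun k => F k + G k := by
  obtain ⟨u, hu⟩ := hF.exists_hasDiff 0
  obtain ⟨v, hv⟩ := hG.exists_hasDiff 0
  exact (hu.add hv).isRegularMap

theorem IsRegularMap.sum {ι : Type*} (s : Finset ι) {F : ι → K → W}
    (h : ∀ i, IsRegularMap (F i)) : IsRegularMap fun k => ∑ i ∈ s, F i k := by
  choose w hw using fun i => (h i).exists_hasDiff 0
  exact (HasDiff.sum s hw).isRegularMap

theorem isRegularMap_iff {F : K → W} : IsRegularMap F ↔
    ∃ (n : ℕ) (f : Fin n → Reg K) (w : Fin n → W), ∀ k, F k = ∑ i, (f i : K → ℂ) k • w i := by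
  constructor
  · rintro ⟨t, ht⟩
    obtain ⟨n, f, w, rfl⟩ := TensorProduct.exists_sum_tmul_eq t
    exact ⟨n, f, w, fun k => by simp [ht]⟩
  · rintro ⟨n, f, w, h⟩
    exact ⟨∑ i, f i ⊗ₜ w i, fun k => by simp [h]⟩

theorem IsRegularMap.mul_right {F : K → W} (h : IsRegularMap F) (k : K) :
    IsRegularMap fun x => F (x * k) := by
  obtain ⟨n, f, w, h⟩ := isRegularMap_iff.1 h
  exact isRegularMap_iff.2 ⟨n, fun i => rightTr k (f i), w, fun x => h (x * k)⟩

/-- The right translates of a regular map form a regular family of maps. -/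
theorem IsRegularMap.translates {F : K → W} (h : IsRegularMap F) :
    IsRegularMap fun (k' : K) (k : K) => F (k * k') := by
  obtain ⟨n, f, w, h⟩ := isRegularMap_iff.1 h
  have : (fun (k' : K) (k : K) => F (k * k')) =
      fun k' => ∑ i, fun k => (f i : K → ℂ) (k * k') • w i := by
    ext k' k
    simp [h]
  rw [this]
  refine IsRegularMap.sum _ fun i => ?_
  obtain ⟨m, a, b, hab⟩ := mul_regular (f i : K → ℂ) (f i).2
  refine isRegularMap_iff.2 ⟨m, b, fun j k => (a j : K → ℂ) k • w i, fun k' => ?_⟩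
  ext k
  simp only [hab, Finset.sum_smul, Finset.sum_apply, Pi.smul_apply]
  exact Finset.sum_congr rfl fun j _ => by rw [mul_comm, mul_smul]

/-- The differential of `x ↦ F (k * x)` in the direction `ξ` is that of `x ↦ F (x * k)` in the
direction `Ad k ξ`. -/
theorem HasDiff.mul_left {ξ : lieAlg K} {F : K → W} (hF : IsRegularMap F) {k : K} {w : W}
    (h : HasDiff (Ad k ξ) (fun x => F (x * k)) w) : HasDiff ξ (fun x => F (k * x)) w := by
  obtain ⟨n, f, v, hf⟩ := isRegularMap_iff.1 hF
  have h1 : HasDiff (Ad k ξ) (fun x => F (x * k)) (∑ i, atOne (Ad k ξ) (rightTr k (f i)) • v i) := by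
    simp only [hf]
    exact HasDiff.sum _ fun i => hasDiff_smul _ (rightTr k (f i)) _
  have h2 : HasDiff ξ (fun x => F (k * x)) (∑ i, atOne ξ (leftTr k (f i)) • v i) := by
    simp only [hf]
    exact HasDiff.sum _ fun i => hasDiff_smul _ (leftTr k (f i)) _
  have h3 (f : Reg K) : atOne (Ad k ξ) (rightTr k f) = atOne ξ (leftTr k f) := by
    have e : rightTr k⁻¹ (rightTr k f) = f := by
      apply Subtype.ext
      funext x
      change (f : K → ℂ) (x * k⁻¹ * k) = (f : K → ℂ) x
      rw [inv_mul_cancel_right]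
    change ((ξ : Derivation ℂ (Reg K) (Reg K)) (rightTr k⁻¹ (rightTr k f)) : K → ℂ) (1 * k) =
      ((ξ : Derivation ℂ (Reg K) (Reg K)) (leftTr k f) : K → ℂ) 1
    rw [ξ.2, e, one_mul]
    change _ = ((ξ : Derivation ℂ (Reg K) (Reg K)) f : K → ℂ) (k * 1)
    rw [mul_one]
  simp only [h3] at h1
  rwa [h.unique h1]

end Calculus

section Representation

variable {K : Type u} [Group K] [AffineAlgGroup K] {V : Type u} [AddCommGroup V] [Module ℂ V]

theorem isAlgebraic_iff {ν : Representation ℂ K V} :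
    IsAlgebraic ν ↔ ∀ v, IsRegularMap fun k => ν k v :=
  forall_congr' fun _ => isRegularMap_iff.symm

theorem IsDifferential.hasDiff {ν : Representation ℂ K V} (hν : IsAlgebraic ν) {ξ : lieAlg K}
    {T : V → V} (h : IsDifferential ν ξ T) (v : V) : HasDiff ξ (fun k => ν k v) (T v) := by
  obtain ⟨n, f, w, hf⟩ := hν v
  rw [h v n f w hf]
  simp only [hf]
  exact HasDiff.sum _ fun i => hasDiff_smul _ _ _

end Representation

end AffineAlgGroup

/-! ### Right invariant vector fields -/

namespace AffineAlgGroup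

section LeftDer

variable {K : Type u} [Group K] [AffineAlgGroup K]

/-- The comultiplication of `R(K)`, through which left and right translates of `f` are expressed. -/
theorem exists_comul (f : Reg K) : ∃ (n : ℕ) (g h : Fin n → Reg K),
    (∀ x, leftTr x f = ∑ i, (g i : K → ℂ) x • h i) ∧
    (∀ x, rightTr x f = ∑ i, (h i : K → ℂ) x • g i) := by
  obtain ⟨n, g, h, H⟩ := mul_regular (f : K → ℂ) f.2
  refine ⟨n, g, h, fun x => ?_, fun x => ?_⟩ <;>
  · apply Subtype.ext
    funext y
    first
    | change (f : K → ℂ) (x * y) = _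
    | change (f : K → ℂ) (y * x) = _
    simp [H, Finset.sum_apply, mul_comm]

theorem leftDer_eq (ξ : lieAlg K) {f : Reg K} {n : ℕ} {g h : Fin n → Reg K}
    (H : ∀ x, rightTr x f = ∑ i, (h i : K → ℂ) x • g i) :
    (fun k => atOne ξ (rightTr k f)) = ((∑ i, atOne ξ (g i) • h i : Reg K) : K → ℂ) := by
  funext k
  rw [H, ← atOneLinear_apply, map_sum]
  simp [Finset.sum_apply, mul_comm]

/-- The right invariant vector field with value `ξ` at the identity:
the derivative at `x = 1` of `f (x * k)`, as a function of `k`. -/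
def leftDer (ξ : lieAlg K) : Reg K →ₗ[ℂ] Reg K where
  toFun f := ⟨fun k => atOne ξ (rightTr k f), by
    obtain ⟨n, g, h, -, H⟩ := exists_comul f
    rw [leftDer_eq ξ H]
    exact Subtype.prop _⟩
  map_add' f g := by
    apply Subtype.ext
    funext k
    change atOneLinear ξ (rightTr k (f + g)) = atOneLinear ξ (rightTr k f) + _
    rw [map_add, map_add]
    rfl
  map_smul' c f := by
    apply Subtype.ext
    funext k
    change atOneLinear ξ (rightTr k (c • f)) = c • atOneLinear ξ (rightTr k f)
    rw [map_smul, map_smul]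

theorem leftDer_apply (ξ : lieAlg K) (f : Reg K) (k : K) :
    (leftDer ξ f : K → ℂ) k = atOne ξ (rightTr k f) := rfl

theorem hasDiff_leftTr (ξ : lieAlg K) (f : Reg K) :
    HasDiff ξ (fun x => leftTr x f) (leftDer ξ f) := by
  obtain ⟨n, g, h, H, H'⟩ := exists_comul f
  have : leftDer ξ f = ∑ i, atOne ξ (g i) • h i := Subtype.ext (leftDer_eq ξ H')
  rw [this]
  simp only [H]
  exact HasDiff.sum _ fun i => hasDiff_smul _ _ _

theorem leftDer_rightTr (ξ : lieAlg K) (k : K) (f : Reg K) :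
    leftDer ξ (rightTr k f) = rightTr k (leftDer ξ f) := by
  apply Subtype.ext
  funext x
  change atOne ξ (rightTr x (rightTr k f)) = atOne ξ (rightTr (x * k) f)
  congr 1
  apply Subtype.ext
  funext y
  change (f : K → ℂ) (y * x * k) = (f : K → ℂ) (y * (x * k))
  rw [mul_assoc]

/-- Both sides contract the comultiplication of `f` with `η` in the first and `ξ` in the second factor. -/
theorem atOne_leftDer (ξ η : lieAlg K) (f : Reg K) :
    atOne ξ (leftDer η f) = atOne η ((ξ : Derivation ℂ (Reg K) (Reg K)) f) := by
  obtain ⟨n, g, h, H, H'⟩ := exists_comul f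
  have h1 : leftDer η f = ∑ i, atOne η (g i) • h i := Subtype.ext (leftDer_eq η H')
  have h2 : (ξ : Derivation ℂ (Reg K) (Reg K)) f = ∑ i, atOne ξ (h i) • g i := by
    apply Subtype.ext
    funext x
    have : ((ξ : Derivation ℂ (Reg K) (Reg K)) f : K → ℂ) x = atOne ξ (leftTr x f) := by
      rw [atOne, ξ.2]
      change _ = ((ξ : Derivation ℂ (Reg K) (Reg K)) f : K → ℂ) (x * 1)
      rw [mul_one]
    rw [this, H, ← atOneLinear_apply, map_sum]
    simp [Finset.sum_apply, mul_comm]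
  rw [h1, h2, ← atOneLinear_apply, ← atOneLinear_apply, map_sum, map_sum]
  simp [mul_comm]

/-- Right invariant vector fields form an anti-representation of the Lie algebra of left invariant ones. -/
theorem leftDer_lie (ξ η : lieAlg K) (f : Reg K) :
    leftDer ⁅ξ, η⁆ f = leftDer η (leftDer ξ f) - leftDer ξ (leftDer η f) := by
  apply Subtype.ext
  funext k
  change _ = (leftDer η (leftDer ξ f) : K → ℂ) k - (leftDer ξ (leftDer η f) : K → ℂ) k
  rw [leftDer_apply, leftDer_apply, leftDer_apply, ← leftDer_rightTr, ← leftDer_rightTr,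
    atOne_leftDer, atOne_leftDer]
  simp [atOne, Derivation.commutator_apply]

/-- Finitely many regular functions lie in a finite dimensional space of regular functions which is
stable under left translations, hence under right invariant vector fields. -/
theorem exists_finite_stable {n : ℕ} (f : Fin n → Reg K) : ∃ S : Submodule ℂ (Reg K),
    FiniteDimensional ℂ S ∧ (∀ i, f i ∈ S) ∧ ∀ ξ : lieAlg K, ∀ s ∈ S, leftDer ξ s ∈ S := by
  choose m g h H H' using fun i => exists_comul (f i)
  let S : Submodule ℂ (Reg K) :=
    Submodule.span ℂ (Set.range fun p : K × Fin n => leftTr p.1 (f p.2))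
  let S' : Submodule ℂ (Reg K) :=
    Submodule.span ℂ (Set.range fun p : (i : Fin n) × Fin (m i) => h p.1 p.2)
  have hS' : FiniteDimensional ℂ S' := FiniteDimensional.span_of_finite ℂ (Set.finite_range _)
  have hSS' : S ≤ S' := by
    refine Submodule.span_le.2 ?_
    rintro _ ⟨⟨x, i⟩, rfl⟩
    simp only [H]
    exact sum_mem fun j _ => S'.smul_mem _ (Submodule.subset_span ⟨⟨i, j⟩, rfl⟩)
  have hT : ∀ x : K, ∀ s ∈ S, leftTr x s ∈ S := by
    intro x s hs
    have : S ≤ S.comap (leftTr x).toLinearMap := by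
      refine Submodule.span_le.2 ?_
      rintro _ ⟨⟨y, i⟩, rfl⟩
      refine Submodule.subset_span ⟨⟨y * x, i⟩, ?_⟩
      apply Subtype.ext
      funext z
      change (f i : K → ℂ) (y * x * z) = (f i : K → ℂ) (y * (x * z))
      rw [mul_assoc]
    exact this hs
  refine ⟨S, Submodule.finiteDimensional_of_le hSS', fun i => ?_, fun ξ s hs => ?_⟩
  · refine Submodule.subset_span ⟨⟨1, i⟩, ?_⟩
    apply Subtype.ext
    funext z
    change (f i : K → ℂ) (1 * z) = (f i : K → ℂ) z
    rw [one_mul]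
  · exact (hasDiff_leftTr ξ s).mem S fun x => hT x s hs

/-- The space of `exists_finite_stable`, with the operators that right invariant vector fields induce
on it, as an abstract vector space with an injection `j` to `R(K)`. -/
theorem exists_finite_antiRep {n : ℕ} (f : Fin n → Reg K) :
    ∃ (S : Type u) (_ : AddCommGroup S) (_ : Module ℂ S) (_ : FiniteDimensional ℂ S)
      (l : lieAlg K →ₗ[ℂ] Module.End ℂ S) (j : S →ₗ[ℂ] Reg K),
      (∀ ξ η, l ⁅ξ, η⁆ = l η * l ξ - l ξ * l η) ∧ (∀ ξ s, j (l ξ s) = leftDer ξ (j s)) ∧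
        ∀ i, ∃ s, j s = f i := by
  obtain ⟨S, hfin, hf, hS⟩ := exists_finite_stable f
  let l : lieAlg K →ₗ[ℂ] Module.End ℂ S :=
    { toFun := fun ξ => (leftDer ξ).restrict (hS ξ)
      map_add' := fun _ _ => LinearMap.ext fun _ => rfl
      map_smul' := fun _ _ => LinearMap.ext fun _ => rfl }
  exact ⟨S, inferInstance, inferInstance, hfin, l, S.subtype,
    fun ξ η => LinearMap.ext fun s => Subtype.ext (leftDer_lie ξ η s), fun _ _ => rfl,
    fun i => ⟨⟨f i, hf i⟩, rfl⟩⟩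

end LeftDer

/-- The differential of a regular map to a space of linear maps can be computed pointwise. -/
theorem HasDiff.of_apply {K : Type u} [Group K] [AffineAlgGroup K] {V W : Type*} [AddCommGroup V]
    [Module ℂ V] [AddCommGroup W] [Module ℂ W] {ξ : lieAlg K} {F : K → V →ₗ[ℂ] W} {T : V →ₗ[ℂ] W}
    (hF : IsRegularMap F) (h : ∀ v, HasDiff ξ (fun k => F k v) (T v)) : HasDiff ξ F T := by
  obtain ⟨T', hT'⟩ := hF.exists_hasDiff ξ
  have : T = T' := by
    ext v
    exact (h v).unique (hT'.map (LinearMap.applyₗ v))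
  rwa [this]

end AffineAlgGroup

/-! ### The coinduced space -/

section Coind

variable {K : Type u} [Group K] [AffineAlgGroup K] {A : Type u} [Ring A] [Algebra ℂ A]
variable {W W' : Type u} [AddCommGroup W] [Module ℂ W] [AddCommGroup W'] [Module ℂ W']

/-- The regular maps `F : K → Hom(A, W)` such that the derivative of `F (x * k)` at `x = 1` in the
direction `ξ` is `a ↦ F k (a * ψ ξ) + r ξ (F k a)`. The model is `F k a = f (a * ν(k) v)`, for a
vector `v` of a module with compatible actions of `A` and `K` and a linear map `f` to `W`. -/
def coind (α : KAlgebra K A) (r : lieAlg K → Module.End ℂ W) :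
    Submodule ℂ (K → A →ₗ[ℂ] W) where
  carrier := {F | IsRegularMap F ∧ ∀ ξ k, HasDiff ξ (fun x => F (x * k))
    (F k ∘ₗ LinearMap.mulRight ℂ (α.ψ ξ) + r ξ ∘ₗ F k)}
  add_mem' := by
    rintro F G ⟨hF, hF'⟩ ⟨hG, hG'⟩
    refine ⟨hF.add hG, fun ξ k => ?_⟩
    refine ((hF' ξ k).add (hG' ξ k)).congr_diff (LinearMap.ext fun a => ?_)
    simp
    abel
  zero_mem' := by
    refine ⟨(hasDiff_zero 0).isRegularMap, fun ξ k => ?_⟩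
    simpa using hasDiff_zero ξ
  smul_mem' := by
    rintro c F ⟨hF, hF'⟩
    refine ⟨hF.map (c • LinearMap.id), fun ξ k => ?_⟩
    refine ((hF' ξ k).map (c • LinearMap.id)).congr_diff (LinearMap.ext fun a => ?_)
    simp

/-- A linear map that intertwines the operators of `𝔨` acts on the coinduced spaces. -/
theorem coind_map {α : KAlgebra K A} {r : lieAlg K → Module.End ℂ W}
    {r' : lieAlg K → Module.End ℂ W'} (T : W →ₗ[ℂ] W') (hT : ∀ ξ w, T (r ξ w) = r' ξ (T w))
    {F : K → A →ₗ[ℂ] W} (hF : F ∈ coind α r) : (fun k => T ∘ₗ F k) ∈ coind α r' := by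
  refine ⟨hF.1.map (LinearMap.compRight ℂ T), fun ξ k => ?_⟩
  refine ((hF.2 ξ k).map (LinearMap.compRight ℂ T)).congr_diff (LinearMap.ext fun a => ?_)
  simp [hT]

theorem coind_translate {α : KAlgebra K A} {r : lieAlg K → Module.End ℂ W}
    (k' : K) {F : K → A →ₗ[ℂ] W} (hF : F ∈ coind α r) : (fun k => F (k * k')) ∈ coind α r := by
  refine ⟨hF.1.mul_right k', fun ξ k => ?_⟩
  simpa only [mul_assoc] using hF.2 ξ (k * k')

/-- Induction on the enveloping algebra by right multiplication with elements of the Lie algebra. -/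
theorem UniversalEnvelopingAlgebra.eq_top_of_mul_ι_mem {R L : Type*} [CommRing R] [LieRing L]
    [LieAlgebra R L] (Q : Submodule R (UniversalEnvelopingAlgebra R L)) (one : 1 ∈ Q)
    (mul : ∀ u ∈ Q, ∀ x, u * ι R x ∈ Q) : Q = ⊤ := by
  let B : Subalgebra R (UniversalEnvelopingAlgebra R L) :=
    { carrier := {y | ∀ u ∈ Q, u * y ∈ Q}
      mul_mem' := fun {a b} ha hb u hu => by
        rw [← mul_assoc]
        exact hb _ (ha _ hu)
      add_mem' := fun {a b} ha hb u hu => by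
        rw [mul_add]
        exact add_mem (ha _ hu) (hb _ hu)
      algebraMap_mem' := fun c u hu => by
        rw [← Algebra.commutes, ← Algebra.smul_def]
        exact Q.smul_mem c hu }
  let j : L →ₗ⁅R⁆ B :=
    { toFun := fun x => ⟨ι R x, fun u hu => mul u hu x⟩
      map_add' := fun x y => by ext; simp
      map_smul' := fun c x => by ext; simp
      map_lie' := fun {x y} => by
        ext
        simp [LieRing.of_associative_ring_bracket] }
  have h : B.val.comp (lift R j) = AlgHom.id R _ := by
    ext x
    simp [j]
  refine eq_top_iff.2 fun y _ => ?_
  have hy : y ∈ B := by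
    rw [← AlgHom.id_apply (R := R) y, ← h]
    exact (lift R j y).2
  simpa using hy 1 one

/-- The commutator action of `𝔨` preserves a `K`-stable subspace of `A`. -/
theorem KAlgebra.commutator_mem (α : KAlgebra K A) {P : Submodule ℂ A}
    (hP : ∀ k : K, ∀ p ∈ P, α.φ k p ∈ P) (ξ : lieAlg K) {p : A} (hp : p ∈ P) :
    α.ψ ξ * p - p * α.ψ ξ ∈ P :=
  ((α.differential ξ).hasDiff α.algebraic p).mem P fun k => hP k p hp

/-- If `A` is spanned by the `ψ(u) p`, it is generated by `P` under right multiplications too. -/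
theorem KAlgebra.eq_top_of_mul_right_mem (α : KAlgebra K A) {P : Submodule ℂ A}
    (hP : ∀ k : K, ∀ p ∈ P, α.φ k p ∈ P) (hsurj : Function.Surjective (TensorProduct.lift
      ((LinearMap.mul ℂ A).compl₁₂ (UniversalEnvelopingAlgebra.lift ℂ α.ψ).toLinearMap P.subtype)))
    (N : Submodule ℂ A) (hPN : P ≤ N) (hN : ∀ a ∈ N, ∀ ξ, a * α.ψ ξ ∈ N) : N = ⊤ := by
  let Q : Submodule ℂ (UniversalEnvelopingAlgebra ℂ (lieAlg K)) :=
    { carrier := {u | ∀ p ∈ P, UniversalEnvelopingAlgebra.lift ℂ α.ψ u * p ∈ N}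
      add_mem' := fun {a b} ha hb p hp => by
        rw [map_add, add_mul]
        exact add_mem (ha p hp) (hb p hp)
      zero_mem' := fun p hp => by simp
      smul_mem' := fun c a ha p hp => by
        rw [map_smul, smul_mul_assoc]
        exact N.smul_mem c (ha p hp) }
  have hQ : Q = ⊤ := by
    refine UniversalEnvelopingAlgebra.eq_top_of_mul_ι_mem Q (fun p hp => ?_) fun u hu ξ p hp => ?_
    · simpa using hPN hp
    · rw [map_mul, UniversalEnvelopingAlgebra.lift_ι_apply]
      have := add_mem (hN _ (hu p hp) ξ) (hu _ (α.commutator_mem hP ξ hp))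
      convert this using 1
      noncomm_ring
  refine eq_top_iff.2 fun a _ => ?_
  obtain ⟨t, rfl⟩ := hsurj a
  induction t with
  | zero => simp
  | add s t hs ht => simpa using add_mem (hs trivial) (ht trivial)
  | tmul u p =>
    have hu : u ∈ Q := hQ ▸ Submodule.mem_top
    exact hu p p.2

/-- An element of the coinduced space is determined by its restriction to `P`. -/
theorem coind_eq_zero {α : KAlgebra K A} {r : lieAlg K → Module.End ℂ W} {P : Submodule ℂ A}
    (hP : ∀ k : K, ∀ p ∈ P, α.φ k p ∈ P) (hsurj : Function.Surjective (TensorProduct.lift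
      ((LinearMap.mul ℂ A).compl₁₂ (UniversalEnvelopingAlgebra.lift ℂ α.ψ).toLinearMap P.subtype)))
    {F : K → A →ₗ[ℂ] W} (hF : F ∈ coind α r) (h0 : ∀ k, ∀ p ∈ P, F k p = 0) : F = 0 := by
  have key := α.eq_top_of_mul_right_mem hP hsurj (⨅ k, LinearMap.ker (F k))
    (fun p hp => by simpa using fun k => h0 k p hp) ?_
  · ext k a
    have : a ∈ ⨅ k, LinearMap.ker (F k) := key ▸ Submodule.mem_top
    simpa using (Submodule.mem_iInf _).1 this k
  · intro a ha ξ
    simp only [Submodule.mem_iInf, LinearMap.mem_ker] at ha ⊢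
    intro k
    have h1 := (hF.2 ξ k).map (LinearMap.applyₗ a)
    simp only [LinearMap.applyₗ_apply_apply, ha] at h1
    simpa [ha] using h1.unique (hasDiff_zero ξ)

/-- Combining an anti-representation `T` of `L` on `M` with a representation `c` on `P` gives
operators `g ↦ T x ∘ g + g ∘ c x` on `Hom(P, M)` which again form an anti-representation. -/
def homAntiRep {L P M : Type*} [LieRing L] [LieAlgebra ℂ L] [AddCommGroup P] [Module ℂ P]
    [AddCommGroup M] [Module ℂ M] (c : L →ₗ⁅ℂ⁆ Module.End ℂ P) (T : L →ₗ[ℂ] Module.End ℂ M)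
    (hT : ∀ x y, T ⁅x, y⁆ = T y * T x - T x * T y) :
    L →ₗ⁅ℂ⁆ (Module.End ℂ (P →ₗ[ℂ] M))ᵐᵒᵖ where
  toFun x := MulOpposite.op (LinearMap.compRight ℂ (T x) + LinearMap.lcomp ℂ M (c x))
  map_add' x y := by
    apply MulOpposite.unop_injective
    ext g p
    simp
    abel
  map_smul' a x := by
    apply MulOpposite.unop_injective
    ext g p
    simp
  map_lie' {x y} := by
    apply MulOpposite.unop_injective
    ext g p
    simp [hT, LieRing.of_associative_ring_bracket]
    abel

/-- The tensor product of the anti-representation `l` with the negative of the representation `r`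
is an anti-representation. -/
def tensorAntiRep {L S W : Type*} [LieRing L] [LieAlgebra ℂ L] [AddCommGroup S] [Module ℂ S]
    [AddCommGroup W] [Module ℂ W] (l : L →ₗ[ℂ] Module.End ℂ S) (r : L →ₗ[ℂ] Module.End ℂ W) :
    L →ₗ[ℂ] Module.End ℂ (S ⊗[ℂ] W) :=
  LinearMap.rTensorHom W ∘ₗ l - LinearMap.lTensorHom S ∘ₗ r

theorem tensorAntiRep_apply {L S W : Type*} [LieRing L] [LieAlgebra ℂ L] [AddCommGroup S]
    [Module ℂ S] [AddCommGroup W] [Module ℂ W] (l : L →ₗ[ℂ] Module.End ℂ S)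
    (r : L →ₗ[ℂ] Module.End ℂ W) (x : L) (t : S ⊗[ℂ] W) :
    tensorAntiRep l r x t = (l x).rTensor W t - (r x).lTensor S t := rfl

theorem tensorAntiRep_lie {L S W : Type*} [LieRing L] [LieAlgebra ℂ L] [AddCommGroup S]
    [Module ℂ S] [AddCommGroup W] [Module ℂ W] {l : L →ₗ[ℂ] Module.End ℂ S}
    (hl : ∀ x y, l ⁅x, y⁆ = l y * l x - l x * l y) (r : L →ₗ⁅ℂ⁆ Module.End ℂ W) (x y : L) :
    tensorAntiRep l (r : L →ₗ[ℂ] Module.End ℂ W) ⁅x, y⁆ =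
      tensorAntiRep l (r : L →ₗ[ℂ] Module.End ℂ W) y * tensorAntiRep l (r : L →ₗ[ℂ] Module.End ℂ W) x - tensorAntiRep l (r : L →ₗ[ℂ] Module.End ℂ W) x * tensorAntiRep l (r : L →ₗ[ℂ] Module.End ℂ W) y := by
  apply TensorProduct.ext'
  intro s w
  simp only [tensorAntiRep_apply, LinearMap.sub_apply, Module.End.mul_apply, LinearMap.rTensor_tmul,
    LinearMap.lTensor_tmul, map_sub, hl, LieHom.coe_toLinearMap, LieHom.map_lie,
    LieRing.of_associative_ring_bracket, TensorProduct.sub_tmul, TensorProduct.tmul_sub]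
  abel

/-- The commutator action of `𝔨` on a `K`-stable subspace of `A`. -/
def KAlgebra.commutatorRep (α : KAlgebra K A) {P : Submodule ℂ A}
    (hP : ∀ k : K, ∀ p ∈ P, α.φ k p ∈ P) : lieAlg K →ₗ⁅ℂ⁆ Module.End ℂ P where
  toFun ξ := (LinearMap.mulLeft ℂ (α.ψ ξ) - LinearMap.mulRight ℂ (α.ψ ξ)).restrict
    fun _ hp => α.commutator_mem hP ξ hp
  map_add' ξ η := by
    apply LinearMap.ext
    intro p
    apply Subtype.ext
    change α.ψ (ξ + η) * (p : A) - p * α.ψ (ξ + η) =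
      (α.ψ ξ * p - p * α.ψ ξ) + (α.ψ η * p - p * α.ψ η)
    rw [map_add]
    noncomm_ring
  map_smul' a ξ := by
    apply LinearMap.ext
    intro p
    apply Subtype.ext
    change α.ψ (a • ξ) * (p : A) - p * α.ψ (a • ξ) = a • (α.ψ ξ * p - p * α.ψ ξ)
    rw [map_smul, smul_mul_assoc, mul_smul_comm, smul_sub]
  map_lie' {ξ η} := by
    apply LinearMap.ext
    intro p
    apply Subtype.ext
    change α.ψ ⁅ξ, η⁆ * (p : A) - p * α.ψ ⁅ξ, η⁆ =
      (α.ψ ξ * (α.ψ η * p - p * α.ψ η) - (α.ψ η * p - p * α.ψ η) * α.ψ ξ) -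
      (α.ψ η * (α.ψ ξ * p - p * α.ψ ξ) - (α.ψ ξ * p - p * α.ψ ξ) * α.ψ η)
    rw [LieHom.map_lie, LieRing.of_associative_ring_bracket]
    noncomm_ring

/-- If `A` is freely generated by `P` under left multiplications, a linear map on `P` extends to a map
on `A` that turns right multiplication by `ψ ξ` into `T ξ`, for any anti-representation `T`. -/
theorem KAlgebra.exists_extension (α : KAlgebra K A) {P : Submodule ℂ A}
    (hP : ∀ k : K, ∀ p ∈ P, α.φ k p ∈ P)
    (hbij : Function.Bijective (TensorProduct.lift
      ((LinearMap.mul ℂ A).compl₁₂ (UniversalEnvelopingAlgebra.lift ℂ α.ψ).toLinearMap P.subtype)))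
    {M : Type*} [AddCommGroup M] [Module ℂ M] (T : lieAlg K →ₗ[ℂ] Module.End ℂ M)
    (hT : ∀ ξ η, T ⁅ξ, η⁆ = T η * T ξ - T ξ * T η) (g₀ : P →ₗ[ℂ] M) :
    ∃ g : A →ₗ[ℂ] M, (∀ a ξ, g (a * α.ψ ξ) = T ξ (g a)) ∧ ∀ p : P, g p = g₀ p := by
  -- `E u g₀` is the map `p ↦ g (ψ(u) p)`
  let E := UniversalEnvelopingAlgebra.lift ℂ (homAntiRep (α.commutatorRep hP) T hT)
  let e := LinearEquiv.ofBijective _ hbij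
  let g : A →ₗ[ℂ] M :=
    TensorProduct.lift (LinearMap.applyₗ g₀ ∘ₗ (MulOpposite.opLinearEquiv ℂ).symm.toLinearMap ∘ₗ
      E.toLinearMap) ∘ₗ e.symm.toLinearMap
  have hg : ∀ u (p : P), g (UniversalEnvelopingAlgebra.lift ℂ α.ψ u * p) =
      (E u).unop g₀ p := by
    intro u p
    have : UniversalEnvelopingAlgebra.lift ℂ α.ψ u * p = e (u ⊗ₜ p) := rfl
    rw [this]
    simp [g]
  refine ⟨g, fun a ξ => ?_, fun p => ?_⟩
  · obtain ⟨t, rfl⟩ := e.surjective a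
    induction t with
    | zero => simp
    | add s t hs ht => simp only [map_add, add_mul, hs, ht]
    | tmul u p =>
      have h1 : e (u ⊗ₜ p) = UniversalEnvelopingAlgebra.lift ℂ α.ψ u * p := rfl
      have h2 : UniversalEnvelopingAlgebra.lift ℂ α.ψ u * (p : A) * α.ψ ξ =
          UniversalEnvelopingAlgebra.lift ℂ α.ψ (u * UniversalEnvelopingAlgebra.ι ℂ ξ) * (p : A) -
            UniversalEnvelopingAlgebra.lift ℂ α.ψ u * (α.commutatorRep hP ξ p : P) := by
        have : ((α.commutatorRep hP ξ p : P) : A) = α.ψ ξ * p - p * α.ψ ξ := rfl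
        rw [this, map_mul, UniversalEnvelopingAlgebra.lift_ι_apply]
        noncomm_ring
      rw [h1, h2, map_sub, hg, hg, hg, map_mul]
      simp [E, homAntiRep]
  · simpa using hg 1 p

section FiniteFamilies

variable {S : Type*} [AddCommGroup S] [Module ℂ S] (j : S →ₗ[ℂ] Reg K)

/-- The value at `k` of an element of `S ⊗ W`, where `S` maps to the ring of regular functions. -/
def evalFamily (W : Type*) [AddCommGroup W] [Module ℂ W] (k : K) : S ⊗[ℂ] W →ₗ[ℂ] W :=
  evalTensor k ∘ₗ j.rTensor W

theorem evalFamily_tmul (k : K) (s : S) (w : W) :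
    evalFamily j W k (s ⊗ₜ w) = (j s : K → ℂ) k • w := rfl

theorem isRegularMap_evalFamily [FiniteDimensional ℂ S] : IsRegularMap (evalFamily j W) := by
  let b := Module.finBasis ℂ S
  refine isRegularMap_iff.2 ⟨_, fun i => j (b i),
    fun i => (TensorProduct.lid ℂ W).toLinearMap ∘ₗ (b.coord i).rTensor W, fun k => ?_⟩
  apply TensorProduct.ext'
  intro s v
  have h : (j s : K → ℂ) k = ∑ i, b.repr s i * (j (b i) : K → ℂ) k := by
    conv_lhs => rw [← b.sum_repr s, map_sum]
    simp [Finset.sum_apply]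
  rw [evalFamily_tmul, h]
  simp [Finset.sum_smul, mul_smul, smul_comm (b.repr s _)]

theorem hasDiff_evalFamily {ξ : lieAlg K} {T : Module.End ℂ S}
    (hj : ∀ s, j (T s) = leftDer ξ (j s)) (k : K) (t : S ⊗[ℂ] W) :
    HasDiff ξ (fun x => evalFamily j W (x * k) t) (evalFamily j W k (T.rTensor W t)) := by
  induction t with
  | zero => simpa using hasDiff_zero ξ
  | add s t hs ht => simpa only [map_add] using hs.add ht
  | tmul s v =>
    rw [LinearMap.rTensor_tmul, evalFamily_tmul, hj]
    exact hasDiff_smul ξ (rightTr k (j s)) v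

theorem evalFamily_lTensor (T : Module.End ℂ W) (k : K) (t : S ⊗[ℂ] W) :
    evalFamily j W k (T.lTensor S t) = T (evalFamily j W k t) := by
  induction t with
  | zero => simp
  | add s t hs ht => simp only [map_add, hs, ht]
  | tmul s v => simp [evalFamily_tmul]

end FiniteFamilies

/-- Any regular map `K → Hom(P, W)` is the restriction of an element of the coinduced space. The
extension takes values in `S ⊗ W` for a finite dimensional space `S` of regular functions, which
makes it regular uniformly in `A`. -/
theorem exists_coind_extension {α : KAlgebra K A} (r : lieAlg K →ₗ⁅ℂ⁆ Module.End ℂ W)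
    {P : Submodule ℂ A} (hP : ∀ k : K, ∀ p ∈ P, α.φ k p ∈ P)
    (hbij : Function.Bijective (TensorProduct.lift
      ((LinearMap.mul ℂ A).compl₁₂ (UniversalEnvelopingAlgebra.lift ℂ α.ψ).toLinearMap P.subtype)))
    {G : K → P →ₗ[ℂ] W} (hG : IsRegularMap G) :
    ∃ F ∈ coind α r, ∀ k, ∀ p : P, F k p = G k p := by
  obtain ⟨n, f, w, hf⟩ := isRegularMap_iff.1 hG
  obtain ⟨S, _, _, _, l, j, hl, hj, hs⟩ := exists_finite_antiRep f
  choose s hs using hs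
  have hT := tensorAntiRep_lie hl r
  have hext := α.exists_extension hP hbij (M := S ⊗[ℂ] W) (tensorAntiRep l r)
  obtain ⟨g, hgT, hg⟩ := hext hT (∑ i, TensorProduct.mk ℂ S W (s i) ∘ₗ w i)
  have hF : IsRegularMap fun k => evalFamily j W k ∘ₗ g :=
    (isRegularMap_evalFamily j).map (LinearMap.lcomp ℂ W g)
  refine ⟨fun k => evalFamily j W k ∘ₗ g, ⟨hF, fun ξ k => ?_⟩, fun k p => ?_⟩
  · refine HasDiff.of_apply (hF.mul_right k) fun a => ?_
    refine (hasDiff_evalFamily j (hj ξ) k (g a)).congr_diff ?_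
    simp only [LinearMap.add_apply, LinearMap.comp_apply, LinearMap.mulRight_apply, hgT,
      tensorAntiRep_apply, map_sub, evalFamily_lTensor, LieHom.coe_toLinearMap]
    abel
  · simp [hg, hf, evalFamily_tmul, hs]

end Coind

/-! ### Operations on the coinduced space -/

section CoindOperations

variable {K : Type u} [Group K] [AffineAlgGroup K] {A : Type u} [Ring A] [Algebra ℂ A]
variable {W W' : Type u} [AddCommGroup W] [Module ℂ W] [AddCommGroup W'] [Module ℂ W']
variable {α : KAlgebra K A} {r : lieAlg K → Module.End ℂ W} {r' : lieAlg K → Module.End ℂ W'}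

theorem KAlgebra.isRegularMap_φ (α : KAlgebra K A) (b : A) : IsRegularMap fun k => α.φ k b :=
  isAlgebraic_iff.1 α.algebraic b

theorem KAlgebra.hasDiff_φ (α : KAlgebra K A) (ξ : lieAlg K) (b : A) (k : K) :
    HasDiff ξ (fun x => α.φ (x * k) b) (α.ψ ξ * α.φ k b - α.φ k b * α.ψ ξ) := by
  simp only [map_mul, AlgEquiv.mul_apply]
  exact (α.differential ξ).hasDiff α.algebraic (α.φ k b)

/-- Applying to the values of `F` operators `B (c k)` that depend regularly on `k` and satisfy the
infinitesimal form of equivariance. -/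
theorem coind_bilin {U : Type*} [AddCommGroup U] [Module ℂ U] (B : U →ₗ[ℂ] W →ₗ[ℂ] W')
    {c : K → U} {c' : lieAlg K → K → U}
    (hc : ∀ ξ k, HasDiff ξ (fun x => c (x * k)) (c' ξ k))
    (hB : ∀ ξ k w, B (c' ξ k) w + B (c k) (r ξ w) = r' ξ (B (c k) w))
    {F : K → A →ₗ[ℂ] W} (hF : F ∈ coind α r) : (fun k => B (c k) ∘ₗ F k) ∈ coind α r' := by
  have hc0 : IsRegularMap c := by simpa using (hc 0 1).isRegularMap
  let B' : U →ₗ[ℂ] (A →ₗ[ℂ] W) →ₗ[ℂ] (A →ₗ[ℂ] W') := LinearMap.llcomp ℂ A W W' ∘ₗ B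
  refine ⟨hc0.bilin B' hF.1, fun ξ k => ?_⟩
  refine ((hc ξ k).bilin B' (hF.2 ξ k)).congr_diff (LinearMap.ext fun a => ?_)
  have := hB ξ k (F k a)
  simp [B', ← this]
  abel

theorem coind_mulRight (b : A) {F : K → A →ₗ[ℂ] W} (hF : F ∈ coind α r) :
    (fun k => F k ∘ₗ LinearMap.mulRight ℂ (α.φ k b)) ∈ coind α r := by
  let B : (A →ₗ[ℂ] W) →ₗ[ℂ] A →ₗ[ℂ] (A →ₗ[ℂ] W) :=
    (LinearMap.llcomp ℂ A A W).flip.flip.compl₂ (LinearMap.mul ℂ A).flip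
  refine ⟨hF.1.bilin B (α.isRegularMap_φ b), fun ξ k => ?_⟩
  refine ((hF.2 ξ k).bilin B (α.hasDiff_φ ξ b k)).congr_diff (LinearMap.ext fun a => ?_)
  simp [B, mul_assoc]
  abel

/-- Postcomposition with a linear map that intertwines the operators of `𝔨`. -/
def coindMap (α : KAlgebra K A) (T : W →ₗ[ℂ] W') (hT : ∀ ξ w, T (r ξ w) = r' ξ (T w)) :
    coind α r →ₗ[ℂ] coind α r' where
  toFun F := ⟨fun k => T ∘ₗ F.1 k, coind_map T hT F.2⟩
  map_add' F G := by
    ext k a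
    simp
  map_smul' c F := by
    ext k a
    simp

/-- The action of `A` on the coinduced space, `(b F) k a = F k (a * φ k b)`. -/
def coindAlg (α : KAlgebra K A) (r : lieAlg K → Module.End ℂ W) :
    A →ₐ[ℂ] Module.End ℂ (coind α r) where
  toFun b :=
    { toFun := fun F => ⟨fun k => F.1 k ∘ₗ LinearMap.mulRight ℂ (α.φ k b), coind_mulRight b F.2⟩
      map_add' := fun _ _ => rfl
      map_smul' := fun _ _ => rfl }
  map_one' := by
    ext F k a
    simp
  map_mul' b b' := by
    ext F k a
    simp [mul_assoc]
  map_zero' := by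
    ext F k a
    simp
  map_add' b b' := by
    ext F k a
    simp [mul_add]
  commutes' c := by
    ext F k a
    simp [Algebra.algebraMap_eq_smul_one]

/-- The action of `K` on the coinduced space, `(k' F) k = F (k * k')`. -/
def coindRep (α : KAlgebra K A) (r : lieAlg K → Module.End ℂ W) :
    Representation ℂ K (coind α r) where
  toFun k' :=
    { toFun := fun F => ⟨fun k => F.1 (k * k'), coind_translate k' F.2⟩
      map_add' := fun _ _ => rfl
      map_smul' := fun _ _ => rfl }
  map_one' := by
    ext F k a
    simp
  map_mul' x y := by
    ext F k a
    simp [mul_assoc]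

theorem isAlgebraic_coindRep (α : KAlgebra K A) (r : lieAlg K → Module.End ℂ W) :
    IsAlgebraic (coindRep α r) :=
  isAlgebraic_iff.2 fun F => IsRegularMap.codRestrict (F := fun k' => coindRep α r k' F)
    F.2.1.translates

/-- The differential of the action of `K` on the coinduced space. Differentiating `F (k * k')` at `k' = 1`
in the direction `ξ` amounts to differentiating `F (x * k)` at `x = 1` in the direction `Ad k ξ`,
which the defining condition computes. -/
theorem coindRep_differential (α : KAlgebra K A) (r : lieAlg K → Module.End ℂ W) (ξ : lieAlg K)
    (F G : coind α r) (hG : ∀ k, G.1 k =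
      F.1 k ∘ₗ LinearMap.mulRight ℂ (α.ψ (Ad k ξ)) + r (Ad k ξ) ∘ₗ F.1 k) :
    HasDiff ξ (fun k' => coindRep α r k' F) G := by
  obtain ⟨G', hG'⟩ := (isAlgebraic_iff.1 (isAlgebraic_coindRep α r) F).exists_hasDiff ξ
  refine hG'.congr_diff (Subtype.ext (funext fun k => ?_))
  have h1 := hG'.map (LinearMap.proj k ∘ₗ (coind α r).subtype)
  have h2 := (F.2.2 (Ad k ξ) k).mul_left F.2.1
  rw [hG]
  exact h2.unique h1

end CoindOperations

theorem AffineAlgGroup.isDifferential_of_hasDiff {K : Type u} [Group K] [AffineAlgGroup K]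
    {V : Type u} [AddCommGroup V] [Module ℂ V] {ν : Representation ℂ K V} {ξ : lieAlg K} {T : V → V}
    (h : ∀ v, HasDiff ξ (fun k => ν k v) (T v)) : IsDifferential ν ξ T := by
  intro v n f w hf
  have h' := h v
  simp only [hf] at h'
  exact h'.unique (HasDiff.sum _ fun i => hasDiff_smul _ _ _)

/-! ### The right adjoint of the forgetful functor -/

section RightAdjoint

variable {K : Type u} [Group K] [AffineAlgGroup K] {A : Type u} [Ring A] [Algebra ℂ A]
variable {D : Type u} [Ring D] [Algebra ℂ D] {𝒟 : ℤ → Submodule ℂ D} [GradedAlgebra 𝒟]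
variable {δ : DGAlgebra 𝒟}

theorem DGModule.act_congr (Z : DGModule δ) {i i' j k : ℤ} {h : i + j = k} {h' : i' + j = k}
    {x : 𝒟 i} {x' : 𝒟 i'} (hi : i = i') (hx : (x : D) = x') (v : Z.cpx.X j) :
    Z.act i j k h x v = Z.act i' j k h' x' v := by
  subst hi
  rw [Subtype.ext hx]

/-- The action of `𝔨` on the components of a DG module over `D`. -/
def KDGAlgebra.lieAct (β : KDGAlgebra K δ) (Z : DGModule δ) (j : ℤ) :
    lieAlg K →ₗ⁅ℂ⁆ Module.End ℂ (Z.cpx.X j) where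
  toFun ξ := Z.act 0 j j (zero_add j) ⟨β.ψ ξ, β.ψ_mem ξ⟩
  map_add' ξ η := by
    rw [← map_add]
    congr 1
    exact Subtype.ext (map_add _ _ _)
  map_smul' c ξ := by
    rw [RingHom.id_apply, ← map_smul]
    congr 1
    exact Subtype.ext (map_smul _ _ _)
  map_lie' {ξ η} := by
    apply LinearMap.ext
    intro v
    rw [LieRing.of_associative_ring_bracket]
    change _ = Z.act 0 j j _ _ (Z.act 0 j j _ _ v) - Z.act 0 j j _ _ (Z.act 0 j j _ _ v)
    rw [← Z.mul_act 0 0 j j j, ← Z.mul_act 0 0 j j j, ← LinearMap.sub_apply, ← map_sub]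
    refine Z.act_congr (by simp) ?_ v
    change β.ψ ⁅ξ, η⁆ = β.ψ ξ * β.ψ η - β.ψ η * β.ψ ξ
    rw [LieHom.map_lie, LieRing.of_associative_ring_bracket]

theorem KDGAlgebra.lieAct_apply (β : KDGAlgebra K δ) (Z : DGModule δ) (j : ℤ) (ξ : lieAlg K)
    (v : Z.cpx.X j) :
    β.lieAct Z j ξ v = Z.act 0 j j (zero_add j) ⟨β.ψ ξ, β.ψ_mem ξ⟩ v := rfl

/-- The differential of `Z` commutes with `𝔨`, since `ψ ξ` is a cocycle of degree `0`. -/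
theorem KDGAlgebra.d_lieAct (β : KDGAlgebra K δ) (Z : DGModule δ) (i j : ℤ) (ξ : lieAlg K)
    (v : Z.cpx.X i) :
    (Z.cpx.d i j).hom (β.lieAct Z i ξ v) = β.lieAct Z j ξ ((Z.cpx.d i j).hom v) := by
  by_cases hij : i + 1 = j
  · subst hij
    have h0 : (⟨δ.d (β.ψ ξ), δ.d_mem (β.ψ_mem ξ)⟩ : 𝒟 (0 + 1)) = 0 := Subtype.ext (β.d_ψ ξ)
    refine (Z.d_act 0 i i (zero_add i) ⟨β.ψ ξ, β.ψ_mem ξ⟩ v).trans ?_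
    simp only [h0, map_zero, LinearMap.zero_apply, zero_add, Int.negOnePow_zero, one_smul]
    rfl
  · simp [Z.cpx.shape i j hij]

/-- The orbit map of an element of degree `i` of `D` is regular as a map to `𝒟 i`. -/
theorem KDGAlgebra.hasDiff_φ_mem (β : KDGAlgebra K δ) {i : ℤ} (x : 𝒟 i) (ξ : lieAlg K) (k : K) :
    HasDiff ξ (fun y => (⟨β.φ (y * k) x, β.φ_mem _ x.2⟩ : 𝒟 i))
      ⟨β.ψ ξ * β.φ k x - β.φ k x * β.ψ ξ, sub_mem
        (by simpa using SetLike.mul_mem_graded (β.ψ_mem ξ) (β.φ_mem k x.2))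
        (by simpa using SetLike.mul_mem_graded (β.φ_mem k x.2) (β.ψ_mem ξ))⟩ := by
  have h := β.hasDiff_φ ξ (x : D) k
  have hreg : IsRegularMap (fun y => (⟨β.φ (y * k) x, β.φ_mem _ x.2⟩ : 𝒟 i)) :=
    IsRegularMap.codRestrict h.isRegularMap
  obtain ⟨d, hd⟩ := hreg.exists_hasDiff ξ
  exact hd.congr_diff (Subtype.ext (h.unique (hd.map (𝒟 i).subtype)))

theorem coind_act {α : KAlgebra K A} (β : KDGAlgebra K δ) (Z : DGModule δ) {i j l : ℤ}
    (h : i + j = l) (x : 𝒟 i) {F : K → A →ₗ[ℂ] Z.cpx.X j} (hF : F ∈ coind α (β.lieAct Z j)) :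
    (fun k => Z.act i j l h ⟨β.φ k x, β.φ_mem k x.2⟩ ∘ₗ F k) ∈ coind α (β.lieAct Z l) := by
  refine coind_bilin (Z.act i j l h) (fun ξ k => β.hasDiff_φ_mem x ξ k) (fun ξ k w => ?_) hF
  rw [β.lieAct_apply, β.lieAct_apply, ← Z.mul_act i 0 j j l, ← Z.mul_act 0 i j l l,
    ← eq_sub_iff_add_eq]
  rw [Z.act_congr (i := i + 0) (i' := i) (h' := h)
      (x' := ⟨β.φ k x * β.ψ ξ, by
        simpa using SetLike.mul_mem_graded (β.φ_mem k x.2) (β.ψ_mem ξ)⟩) (by simp) rfl,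
    Z.act_congr (i := 0 + i) (i' := i) (h' := h)
      (x' := ⟨β.ψ ξ * β.φ k x, by
        simpa using SetLike.mul_mem_graded (β.ψ_mem ξ) (β.φ_mem k x.2)⟩) (by simp) rfl,
    ← LinearMap.sub_apply, ← map_sub]
  rfl

/-- The action of `D` on the coinduced spaces, `(x F) k a = (φ k x) (F k a)`. -/
def coindAct (α : KAlgebra K A) (β : KDGAlgebra K δ) (Z : DGModule δ) {i j l : ℤ}
    (h : i + j = l) : 𝒟 i →ₗ[ℂ] coind α (β.lieAct Z j) →ₗ[ℂ] coind α (β.lieAct Z l) :=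
  LinearMap.mk₂ ℂ (fun x F => ⟨_, coind_act β Z h x F.2⟩)
    (fun x y F => by
      ext k a
      change Z.act i j l h ⟨β.φ k (x + y : D), _⟩ (F.1 k a) =
        Z.act i j l h ⟨β.φ k x, _⟩ (F.1 k a) + Z.act i j l h ⟨β.φ k y, _⟩ (F.1 k a)
      rw [← LinearMap.add_apply, ← map_add]
      exact Z.act_congr rfl (map_add (β.φ k) (x : D) y) _)
    (fun c x F => by
      ext k a
      change Z.act i j l h ⟨β.φ k (c • x : D), _⟩ (F.1 k a) =
        c • Z.act i j l h ⟨β.φ k x, _⟩ (F.1 k a)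
      rw [← LinearMap.smul_apply, ← map_smul]
      exact Z.act_congr rfl (map_smul (β.φ k) c (x : D)) _)
    (fun x F G => by
      ext k a
      exact map_add (Z.act i j l h ⟨β.φ k x, β.φ_mem k x.2⟩) (F.1 k a) (G.1 k a))
    (fun c x F => by
      ext k a
      exact map_smul (Z.act i j l h ⟨β.φ k x, β.φ_mem k x.2⟩) c (F.1 k a))

/-- The complex of coinduced spaces of the components of `Z`. -/
def coindComplex (α : KAlgebra K A) (β : KDGAlgebra K δ) (Z : DGModule δ) :
    CochainComplex (ModuleCat.{u} ℂ) ℤ where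
  X j := ModuleCat.of ℂ (coind α (β.lieAct Z j))
  d i j := ModuleCat.ofHom (coindMap α (Z.cpx.d i j).hom (β.d_lieAct Z i j))
  shape i j hij := by
    refine ModuleCat.hom_ext (LinearMap.ext fun F => Subtype.ext (funext fun k =>
      LinearMap.ext fun a => ?_))
    change (Z.cpx.d i j).hom (F.1 k a) = 0
    simp [Z.cpx.shape i j hij]
  d_comp_d' i j l _ _ := by
    refine ModuleCat.hom_ext (LinearMap.ext fun F => Subtype.ext (funext fun k =>
      LinearMap.ext fun a => ?_))
    change (Z.cpx.d i j ≫ Z.cpx.d j l).hom (F.1 k a) = 0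
    simp

/-- The DG module over `D` of coinduced spaces. -/
def coindDGModule (α : KAlgebra K A) (β : KDGAlgebra K δ) (Z : DGModule δ) : DGModule δ where
  cpx := coindComplex α β Z
  act i j l h := coindAct α β Z h
  one_act j F := by
    refine Subtype.ext (funext fun k => LinearMap.ext fun a => ?_)
    refine Eq.trans ?_ (Z.one_act j (F.1 k a))
    exact Z.act_congr rfl (map_one (β.φ k)) _
  mul_act i i' j k l h h' x y F := by
    refine Subtype.ext (funext fun g => LinearMap.ext fun a => ?_)
    refine Eq.trans ?_ (Z.mul_act i i' j k l h h' _ _ (F.1 g a))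
    exact Z.act_congr rfl (map_mul (β.φ g) (x : D) y) _
  d_act i j k h x F := by
    refine Subtype.ext (funext fun g => LinearMap.ext fun a => ?_)
    refine (Z.d_act i j k h _ (F.1 g a)).trans ?_
    change _ = Z.act (i + 1) j (k + 1) _ ⟨β.φ g (δ.d x), _⟩ (F.1 g a) + _
    congr 1
    exact Z.act_congr rfl (β.φ_d g x).symm _

/-- The `(A, K, D)`-module coinduced from a DG module over `D`. -/
def coindModule (α : KAlgebra K A) (β : KDGAlgebra K δ) (Z : DGModule δ) : AKDModule α β where
  toDGModule := coindDGModule α β Z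
  π j := coindAlg α (β.lieAct Z j)
  π_d _ _ _ _ := rfl
  ν j := coindRep α (β.lieAct Z j)
  ν_algebraic j := isAlgebraic_coindRep α (β.lieAct Z j)
  ν_d _ _ _ _ := rfl
  π_act _ _ _ _ _ _ _ := rfl
  ν_π j g b F := by
    refine Subtype.ext (funext fun k => LinearMap.ext fun a => ?_)
    change F.1 (k * g) (a * α.φ (k * g) b) = F.1 (k * g) (a * α.φ k (α.φ g b))
    rw [map_mul α.φ]
    rfl
  ν_act i j l h g x F := by
    refine Subtype.ext (funext fun k => LinearMap.ext fun a => ?_)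
    refine Z.act_congr rfl ?_ (F.1 (k * g) a)
    change β.φ (k * g) (x : D) = β.φ k (β.φ g x)
    rw [map_mul]
    rfl
  differential j ξ := by
    refine isDifferential_of_hasDiff fun F => coindRep_differential α (β.lieAct Z j) ξ F _ fun k => ?_
    apply LinearMap.ext
    intro a
    change F.1 k (a * α.φ k (α.ψ ξ)) + Z.act 0 j j _ ⟨β.φ k (β.ψ ξ), _⟩ (F.1 k a) =
      F.1 k (a * α.ψ (Ad k ξ)) + Z.act 0 j j _ ⟨β.ψ (Ad k ξ), _⟩ (F.1 k a)
    rw [α.equivariant]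
    congr 1
    exact Z.act_congr rfl (β.equivariant k ξ).symm _

/-- The counit of the adjunction, `F ↦ F 1 1`. -/
def coindCounit (α : KAlgebra K A) (β : KDGAlgebra K δ) (Z : DGModule δ) :
    coindDGModule α β Z ⟶ Z :=
  DGModule.Hom.mk
    { f := fun j => ModuleCat.ofHom
        (LinearMap.applyₗ (1 : A) ∘ₗ LinearMap.proj (1 : K) ∘ₗ (coind α (β.lieAct Z j)).subtype)
      comm' := fun _ _ _ => rfl }
    (fun i j k h x F => by
      change Z.act i j k h ⟨β.φ 1 x, _⟩ (F.1 1 1) = Z.act i j k h x (F.1 1 1)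
      exact Z.act_congr rfl (by change β.φ 1 (x : D) = x; rw [map_one]; rfl) _)

/-- The matrix coefficients `k ↦ (a ↦ f (a * ν(k) v))` of an `(A, K, D)`-module `V` lie in the
coinduced space. -/
theorem coeff_mem_coind {α : KAlgebra K A} {β : KDGAlgebra K δ} (V : AKDModule α β) {Z : DGModule δ}
    (f : V.toDGModule ⟶ Z) (j : ℤ) (v : V.cpx.X j) :
    (fun k => (f.chain.f j).hom ∘ₗ (V.π j).toLinearMap.flip (V.ν j k v)) ∈
      coind α (β.lieAct Z j) := by
  let Θ : V.cpx.X j →ₗ[ℂ] A →ₗ[ℂ] Z.cpx.X j :=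
    LinearMap.compRight ℂ (f.chain.f j).hom ∘ₗ (V.π j).toLinearMap.flip
  refine ⟨(isAlgebraic_iff.1 (V.ν_algebraic j) v).map Θ, fun ξ k => ?_⟩
  have h := ((V.differential j ξ).hasDiff (V.ν_algebraic j) (V.ν j k v)).map Θ
  simp only [← Module.End.mul_apply, ← map_mul] at h
  refine h.congr_diff (LinearMap.ext fun a => ?_)
  change (f.chain.f j).hom (V.π j (a * α.ψ ξ) (V.ν j k v)) +
      β.lieAct Z j ξ ((f.chain.f j).hom (V.π j a (V.ν j k v))) =
    (f.chain.f j).hom (V.π j a (V.π j (α.ψ ξ) (V.ν j k v) +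
      V.act 0 j j (zero_add j) ⟨β.ψ ξ, β.ψ_mem ξ⟩ (V.ν j k v)))
  rw [map_add, map_add, map_mul, V.π_act]
  congr 1
  exact (f.map_act 0 j j _ _ _).symm

/-- The morphism to the coinduced module that corresponds to a morphism of DG modules over `D`. -/
def coindLift {α : KAlgebra K A} {β : KDGAlgebra K δ} (V : AKDModule α β) {Z : DGModule δ}
    (f : V.toDGModule ⟶ Z) : V ⟶ coindModule α β Z :=
  AKDModule.Hom.mk
    (DGModule.Hom.mk
      { f := fun j => ModuleCat.ofHom
          { toFun := fun v => (⟨_, coeff_mem_coind V f j v⟩ : coind α (β.lieAct Z j))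
            map_add' := fun v w => by
              ext k a
              simp
            map_smul' := fun c v => by
              ext k a
              simp }
        comm' := fun i j _ => by
          ext v
          apply Subtype.ext
          funext k
          apply LinearMap.ext
          intro a
          change (f.chain.f i ≫ Z.cpx.d i j).hom (V.π i a (V.ν i k v)) =
            (f.chain.f j).hom (V.π j a (V.ν j k ((V.cpx.d i j).hom v)))
          rw [f.chain.comm]
          change (f.chain.f j).hom ((V.cpx.d i j).hom (V.π i a (V.ν i k v))) = _
          rw [V.π_d, V.ν_d] }
      (fun i j l h x v => by
        apply Subtype.ext
        funext k
        apply LinearMap.ext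
        intro a
        change (f.chain.f l).hom (V.π l a (V.ν l k (V.act i j l h x v))) =
          Z.act i j l h ⟨β.φ k x, _⟩ ((f.chain.f j).hom (V.π j a (V.ν j k v)))
        rw [V.ν_act, V.π_act]
        exact f.map_act i j l h _ _))
    (fun j b v => by
      apply Subtype.ext
      funext k
      apply LinearMap.ext
      intro a
      change (f.chain.f j).hom (V.π j a (V.ν j k (V.π j b v))) =
        (f.chain.f j).hom (V.π j (a * α.φ k b) (V.ν j k v))
      rw [V.ν_π, map_mul]
      rfl)
    (fun j g v => by
      apply Subtype.ext
      funext k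
      apply LinearMap.ext
      intro a
      change (f.chain.f j).hom (V.π j a (V.ν j k (V.ν j g v))) =
        (f.chain.f j).hom (V.π j a (V.ν j (k * g) v))
      rw [map_mul]
      rfl)

theorem coindLift_counit {α : KAlgebra K A} {β : KDGAlgebra K δ} (V : AKDModule α β)
    {Z : DGModule δ} (f : V.toDGModule ⟶ Z) :
    (coindLift V f).chain ≫ (coindCounit α β Z).chain = f.chain := by
  ext j v
  change (f.chain.f j).hom (V.π j 1 (V.ν j 1 v)) = (f.chain.f j).hom v
  rw [map_one, map_one]
  rfl

/-! ### Acyclicity and K-projectives -/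

theorem CochainComplex.acyclic_iff_exact {C : CochainComplex (ModuleCat.{u} ℂ) ℤ} :
    C.Acyclic ↔ ∀ j (v : C.X (j + 1)), (C.d (j + 1) (j + 1 + 1)).hom v = 0 →
      ∃ w : C.X j, (C.d j (j + 1)).hom w = v := by
  have key (j : ℤ) : C.ExactAt (j + 1) ↔ ∀ v : C.X (j + 1),
      (C.d (j + 1) (j + 1 + 1)).hom v = 0 → ∃ w : C.X j, (C.d j (j + 1)).hom w = v := by
    rw [C.exactAt_iff' j (j + 1) (j + 1 + 1) (by simp) (by simp),
      ShortComplex.moduleCat_exact_iff]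
    rfl
  refine ⟨fun h j => (key j).1 (h _), fun h i => ?_⟩
  obtain ⟨j, rfl⟩ : ∃ j, i = j + 1 := ⟨i - 1, by ring⟩
  exact (key j).2 (h j)

/-- Coinduction preserves acyclicity: a cocycle `F` restricts to a regular map with values in
`Hom(P, ker d)`, which lifts along a linear section of `d` and then extends to `A`. -/
theorem acyclic_coindModule {α : KAlgebra K A} (hA : α.IsFreeOnKSubmodule) (β : KDGAlgebra K δ)
    {Z : DGModule δ} (hZ : Z.Acyclic) : (coindModule α β Z).Acyclic := by
  obtain ⟨P, hP, hbij⟩ := hA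
  refine CochainComplex.acyclic_iff_exact.2 fun j (F : coind α (β.lieAct Z (j + 1))) hF => ?_
  have hF' : ∀ k a, (Z.cpx.d (j + 1) (j + 1 + 1)).hom (F.1 k a) = 0 := fun k a =>
    LinearMap.congr_fun (congrFun (congrArg Subtype.val hF) k) a
  obtain ⟨s, hs⟩ : ∃ s : Z.cpx.X (j + 1) →ₗ[ℂ] Z.cpx.X j,
      ∀ v, (Z.cpx.d (j + 1) (j + 1 + 1)).hom v = 0 → (Z.cpx.d j (j + 1)).hom (s v) = v := by
    obtain ⟨s, hs⟩ := (Z.cpx.d j (j + 1)).hom.rangeRestrict.exists_rightInverse_of_surjective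
      (LinearMap.range_rangeRestrict _)
    obtain ⟨p, hp⟩ := LinearMap.exists_leftInverse_of_injective
      (LinearMap.range (Z.cpx.d j (j + 1)).hom).subtype (Submodule.ker_subtype _)
    refine ⟨s ∘ₗ p, fun v hv => ?_⟩
    obtain ⟨w, rfl⟩ := CochainComplex.acyclic_iff_exact.1 hZ j v hv
    have h1 := LinearMap.congr_fun hp ((Z.cpx.d j (j + 1)).hom.rangeRestrict w)
    have h2 := congrArg Subtype.val
      (LinearMap.congr_fun hs ((Z.cpx.d j (j + 1)).hom.rangeRestrict w))
    change p ((Z.cpx.d j (j + 1)).hom w) = _ at h1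
    rw [LinearMap.comp_apply, h1]
    exact h2
  have hG : IsRegularMap fun k => s ∘ₗ F.1 k ∘ₗ P.subtype :=
    (F.2.1.map (LinearMap.lcomp ℂ _ P.subtype)).map (LinearMap.compRight ℂ s)
  obtain ⟨G, hG, hGF⟩ := exists_coind_extension (β.lieAct Z j) hP hbij hG
  refine ⟨(⟨G, hG⟩ : coind α (β.lieAct Z j)), ?_⟩
  let G' : coind α (β.lieAct Z (j + 1)) :=
    coindMap α (Z.cpx.d j (j + 1)).hom (β.d_lieAct Z j (j + 1)) ⟨G, hG⟩
  refine (sub_eq_zero (a := G') (b := F)).1 (Subtype.ext ?_)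
  refine coind_eq_zero hP hbij.2 (G' - F).2 fun k p hp => ?_
  change (Z.cpx.d j (j + 1)).hom (G k p) - F.1 k p = 0
  have := hGF k ⟨p, hp⟩
  change G k p = s (F.1 k p) at this
  rw [this, hs _ (hF' k p), sub_self]

end RightAdjoint

theorem proposition2p3 {K : Type u} [Group K] [AffineAlgGroup K] (hK : IsReductive K)
    {A : Type u} [Ring A] [Algebra ℂ A] (α : KAlgebra K A) (hA : α.IsFreeOnKSubmodule)
    {D : Type u} [Ring D] [Algebra ℂ D] {𝒟 : ℤ → Submodule ℂ D} [GradedAlgebra 𝒟]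
    {δ : DGAlgebra 𝒟} (β : KDGAlgebra K δ) (P : AKDModule α β) (hP : P.IsKProjective) :
    ((AKDModule.forget α β).obj P).IsKProjective := by
  intro Z hZ f
  obtain ⟨h, hlin, -, -⟩ := hP (coindModule α β Z) (acyclic_coindModule hA β hZ) (coindLift P f)
  have hcomm := (h.compRight (coindCounit α β Z).chain).comm
  have hcounit := coindLift_counit P f
  refine ⟨{ hom := fun i j => h.hom i j ≫ (coindCounit α β Z).chain.f j
            zero := (h.compRight (coindCounit α β Z).chain).zero
            comm := fun i => (congrArg (fun g => g.f i) hcounit).symm.trans (hcomm i) },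
    fun i j k l m hjk hlm x v => ?_⟩
  have hx := congrArg ((coindCounit α β Z).chain.f m).hom (hlin i j k l m hjk hlm x v)
  refine hx.trans ((map_zsmul ((coindCounit α β Z).chain.f m).hom _ _).trans ?_)
  exact congrArg (i.negOnePow • ·) ((coindCounit α β Z).map_act i l m hlm x (h.hom j l v))
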